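/- Let $q\in\mathbb C$ with $0<|q|<1$. Write $(x;q)_\infty=\prod_{n\ge 0}(1-xq^n)$, $(x;q)_n=\prod_{k=0}^{n-1}(1-xq^k)$ for integers $n\ge 0$, and $(x_1,\dots,x_m;q)_n=(x_1;q)_n\cdots(x_m;q)_n$ (also for $n=\infty$). Put $$\theta(x)=\frac1{(q;q)_\infty}\sum_{n=-\infty}^{\infty}(-1)^nq^{n(n-1)/2}x^n\quad(x\ne 0),\qquad \Omega(x_1,\dots,x_n;a_1,\dots,a_m)=\prod_{i=1}^n\prod_{j=1}^m(x_i/a_j;q)_\infty .$$ Let ${}_8W_7[a;a_4,\dots,a_8;q,x]$ denote the very-well-poised basic hypergeometric series $${}_8W_7[a;a_4,\dots,a_8;q,x]=\sum_{n=0}^\infty \frac{1-aq^{2n}}{1-a}\,\frac{(a,a_4,\dots,a_8;q)_n}{(q,aq/a_4,\dots,aq/a_8;q)_n}\,x^n ,$$ where the factor $1-a$ is cancelled against $(a;q)_n$ for $n\ge 1$ and the term with $n=0$ is $1$ (so that $a=1$ is allowed). Let $a,c,d,e,z$ be nonzero complex numbers with $zq=cde$ and $|aq/z|<1$, such that no denominator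 below vanishes; that is, none of $aq/c,\ aq/d,\ aq/e,\ zq,\ q/a,\ q/c,\ q/d,\ q/e,\ aq/z^2,\ q/z,\ c/z,\ d/z,\ e/z$ is of the form $q^{-n}$ with an integer $n\ge 0$, and $a/z$ is not an integer power of $q$. Then both ${}_8W_7$ series below converge absolutely, and $$\begin{aligned} &{}_8W_7[a;c,d,e,a/z,z;q,aq/z]\\ &=\Big(1-\frac1z\Big)\frac{(q,aq,q/a,aq/z^2;q)_\infty}{\theta(a/z)\,(q/z;q)_\infty}\, \frac{\Omega(q;c,d,e)\,\Omega(aq;cd,ce,de)}{\Omega(aq;c,d,e,z)\,\Omega(1/z;1/c,1/d,1/e)}\; {}_8W_7[1/z;a/z,c/z,d/z,e/z,z/a;q,q]\\ &\quad+\frac1z\,\frac{(q,aq,q/a,a;q)_\infty}{\theta(a/z)\,(zq;q)_\infty}\, \frac{\Omega(1;1/c,1/d,1/e)\,\Omega(aq/z;c,d,e)}{\Omega(1/z;1/c,1/d,1/e)\,\Omega(aq;c,d,e,z)} . \end{aligned}$$ -/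

import Mathlib

namespace BasicHyp

/-- The infinite `q`-shifted factorial `(x; q)_∞ = ∏_{n ≥ 0} (1 - x q^n)` (used for `|q| < 1`). -/
noncomputable def qInf (q x : ℂ) : ℂ := ∏' n : ℕ, (1 - x * q ^ n)

/-- The finite `q`-shifted factorial `(x; q)_n = ∏_{0 ≤ k < n} (1 - x q^k)`, for `n ≥ 0`. -/
noncomputable def qFin (q x : ℂ) (n : ℕ) : ℂ := ∏ k ∈ Finset.range n, (1 - x * q ^ k)

/-- `(x₁, …, x_m; q)_∞`. -/
noncomputable def qInfs (q : ℂ) (xs : List ℂ) : ℂ := (xs.map (qInf q)).prod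

/-- `(x₁, …, x_m; q)_n`. -/
noncomputable def qFins (q : ℂ) (xs : List ℂ) (n : ℕ) : ℂ := (xs.map (fun x => qFin q x n)).prod

/-- The theta function
`θ(x) = (1 / (q; q)_∞) ∑_{n ∈ ℤ} (-1)^n q^{n(n-1)/2} x^n`, for `x ≠ 0`. -/
noncomputable def theta (q x : ℂ) : ℂ :=
  1 / qInf q q * ∑' n : ℤ, (-1 : ℂ) ^ n * q ^ (n * (n - 1) / 2) * x ^ n

/-- `Ω(x₁, …, x_n; a₁, …, a_m) = ∏_i ∏_j (x_i / a_j; q)_∞`. -/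
noncomputable def Omega (q : ℂ) (xs as : List ℂ) : ℂ :=
  (xs.map (fun x => (as.map (fun a => qInf q (x / a))).prod)).prod

/-- The `n`-th term of a basic hypergeometric series with upper parameters `as`, lower parameters
`bs` (one fewer than the upper ones), base `q` and argument `z`. -/
noncomputable def phiTerm (as bs : List ℂ) (q z : ℂ) (n : ℕ) : ℂ :=
  qFins q as n / qFins q bs n * (z ^ n / qFin q q n)

/-- The basic hypergeometric series `_{r+1}φ_r[as; bs; q, z]`. -/
noncomputable def phi (as bs : List ℂ) (q z : ℂ) : ℂ := ∑' n : ℕ, phiTerm as bs q z n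

/-- The very-well-poised factor
`(a, q√a, -q√a; q)_n / (√a, -√a; q)_n = (a; q)_n (1 - a q^{2n}) / (1 - a)`,
with the common factor `1 - a` of `(a; q)_n` and of the denominator cancelled, so that it also has
its usual value when `a = 1`. -/
noncomputable def vwpFactor (q a : ℂ) : ℕ → ℂ
  | 0 => 1
  | n + 1 => (1 - a * q ^ (2 * (n + 1))) * qFin q (a * q) n

/-- The `n`-th term of the very-well-poised series `_{r+1}W_r[a; l; q, z]`, where `l` is the list
of the parameters `a₄, …, a_{r+1}`. -/
noncomputable def WTerm (a : ℂ) (l : List ℂ) (q z : ℂ) (n : ℕ) : ℂ :=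
  vwpFactor q a n * qFins q l n / qFins q (l.map (fun x => a * q / x)) n * (z ^ n / qFin q q n)

/-- The very-well-poised basic hypergeometric series `_{r+1}W_r[a; a₄, …, a_{r+1}; q, z]`; for a
list `l` of five parameters it is an `_8W_7`. -/
noncomputable def W (a : ℂ) (l : List ℂ) (q z : ℂ) : ℂ := ∑' n : ℕ, WTerm a l q z n

theorem qFin_succ (q x : ℂ) (n : ℕ) : qFin q x (n + 1) = qFin q x n * (1 - x * q ^ n) := by
  simp [qFin, Finset.prod_range_succ]

theorem qFin_succ' (q x : ℂ) (n : ℕ) : qFin q x (n + 1) = (1 - x) * qFin q (x * q) n := by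
  simp only [qFin, Finset.prod_range_succ', pow_zero, mul_one]
  rw [mul_comm]
  congr 1
  refine Finset.prod_congr rfl fun k _ => ?_
  ring

theorem vwpFactor_spec (q s : ℂ) (n : ℕ) :
    qFin q (s ^ 2) n * (qFin q (q * s) n * qFin q (-(q * s)) n)
      = vwpFactor q (s ^ 2) n * (qFin q s n * qFin q (-s) n) := by
  cases n with
  | zero => simp [qFin, vwpFactor]
  | succ n =>
    rw [qFin_succ q (q * s), qFin_succ q (-(q * s)), qFin_succ' q (s ^ 2), qFin_succ' q s,
      qFin_succ' q (-s), vwpFactor, mul_comm s q, show -s * q = -(q * s) by ring]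
    ring

theorem vwpFactor_eq (q a : ℂ) (ha : a ≠ 1) (n : ℕ) :
    vwpFactor q a n = qFin q a n * (1 - a * q ^ (2 * n)) / (1 - a) := by
  have h : 1 - a ≠ 0 := sub_ne_zero.2 (Ne.symm ha)
  cases n with
  | zero => simp [qFin, vwpFactor, h]
  | succ n =>
    rw [qFin_succ', vwpFactor]
    field_simp

/-- `W` is the very-well-poised `φ` series with `a₂ = q√a` and `a₃ = -q√a`, whenever the lower
parameters `√a` and `-√a` of the latter are admissible. -/
theorem W_eq_phi (a s q z : ℂ) (l : List ℂ) (hs : s ^ 2 = a)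
    (h₁ : ∀ n : ℕ, s * q ^ n ≠ 1) (h₂ : ∀ n : ℕ, -s * q ^ n ≠ 1) :
    W a l q z
      = phi (a :: (q * s) :: (-(q * s)) :: l) (s :: (-s) :: l.map (fun x => a * q / x)) q z := by
  subst hs
  unfold W phi
  congr 1
  funext n
  have e₁ : qFin q s n ≠ 0 := Finset.prod_ne_zero_iff.2 fun k _ => sub_ne_zero.2 (h₁ k).symm
  have e₂ : qFin q (-s) n ≠ 0 := Finset.prod_ne_zero_iff.2 fun k _ => sub_ne_zero.2 (h₂ k).symm
  have key : vwpFactor q (s ^ 2) n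
      = qFin q (s ^ 2) n * (qFin q (q * s) n * qFin q (-(q * s)) n)
        / (qFin q s n * qFin q (-s) n) := by
    rw [vwpFactor_spec]
    field_simp
  unfold WTerm phiTerm
  rw [key]
  simp only [qFins, List.map_cons, List.prod_cons]
  simp only [div_eq_mul_inv, mul_inv]
  ring

end BasicHyp

/-!
Both sides of the identity, cleared of denominators, satisfy a first-order `q`-difference equation
in `a`: the terms of each `₈W₇` series at `a` and at `a * q` combine to the difference of a
hypergeometric term, up to a `₆φ₅`-type sum on the left which is itself evaluated by iterating a
contiguous relation. The inhomogeneous parts agree, so the difference of the two sides, divided by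
an infinite product, is a holomorphic function on a punctured disc with `f w = -w * f (w * q)`.
Comparing Laurent coefficients on a circle, `f` is a multiple of `θ`; since it vanishes at `a = z`,
where `θ` does not, it is zero.
-/

namespace BasicHyp

open Filter Topology

section ShiftedFactorials

variable {q : ℂ}

@[simp] theorem qFin_zero (q x : ℂ) : qFin q x 0 = 1 := by simp [qFin]

@[simp] theorem qInf_zero (q : ℂ) : qInf q 0 = 1 := by simp [qInf]

@[simp] theorem qFins_nil (q : ℂ) (n : ℕ) : qFins q [] n = 1 := by simp [qFins]

@[simp] theorem qInfs_nil (q : ℂ) : qInfs q [] = 1 := by simp [qInfs]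

@[simp] theorem qFins_cons (q x : ℂ) (xs : List ℂ) (n : ℕ) :
    qFins q (x :: xs) n = qFin q x n * qFins q xs n := by simp [qFins]

@[simp] theorem qInfs_cons (q x : ℂ) (xs : List ℂ) :
    qInfs q (x :: xs) = qInf q x * qInfs q xs := by simp [qInfs]

theorem summable_norm_mul_qpow (hq : ‖q‖ < 1) (x : ℂ) :
    Summable fun n : ℕ => ‖-(x * q ^ n)‖ := by
  simp only [norm_neg, norm_mul, norm_pow]
  exact (summable_geometric_of_lt_one (norm_nonneg _) hq).mul_left _

theorem multipliable_one_sub_mul_qpow (hq : ‖q‖ < 1) (x : ℂ) :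
    Multipliable fun n : ℕ => 1 - x * q ^ n := by
  simpa only [sub_eq_add_neg] using multipliable_one_add_of_summable (summable_norm_mul_qpow hq x)

theorem qFin_mul_qInf (hq : ‖q‖ < 1) (x : ℂ) (n : ℕ) :
    qFin q x n * qInf q (x * q ^ n) = qInf q x := by
  have hshift (m : ℕ) : 1 - x * q ^ n * q ^ m = 1 - x * q ^ (m + n) := by ring
  rw [qInf, qInf, qFin, tprod_congr hshift]
  exact Multipliable.prod_mul_tprod_nat_mul'
    ((multipliable_one_sub_mul_qpow hq (x * q ^ n)).congr hshift)

theorem qInf_eq_mul (hq : ‖q‖ < 1) (x : ℂ) : qInf q x = (1 - x) * qInf q (x * q) := by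
  simpa [qFin] using (qFin_mul_qInf hq x 1).symm

theorem qInf_mul_qpow (hq : ‖q‖ < 1) (x : ℂ) (n : ℕ) :
    qInf q (x * q ^ n) = (1 - x * q ^ n) * qInf q (x * q ^ (n + 1)) := by
  rw [qInf_eq_mul hq, mul_assoc, ← pow_succ]

theorem qFin_ne_zero {x : ℂ} (h : ∀ n : ℕ, x * q ^ n ≠ 1) (n : ℕ) : qFin q x n ≠ 0 :=
  Finset.prod_ne_zero_iff.2 fun k _ => sub_ne_zero.2 (h k).symm

theorem qInf_ne_zero (hq : ‖q‖ < 1) {x : ℂ} (h : ∀ n : ℕ, x * q ^ n ≠ 1) : qInf q x ≠ 0 := by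
  simpa [qInf, sub_eq_add_neg] using tprod_one_add_ne_zero_of_summable
    (f := fun n : ℕ => -(x * q ^ n))
    (fun n => by rw [← sub_eq_add_neg]; exact sub_ne_zero.2 (h n).symm)
    (summable_norm_mul_qpow hq x)

theorem qInf_one (hq : ‖q‖ < 1) : qInf q 1 = 0 := by
  rw [qInf_eq_mul hq, sub_self, zero_mul]

theorem qFin_one_succ (q : ℂ) (n : ℕ) : qFin q 1 (n + 1) = 0 := by
  rw [qFin_succ', sub_self, zero_mul]

theorem self_mul_qpow_ne_one (hq : ‖q‖ < 1) (n : ℕ) : q * q ^ n ≠ 1 := fun h => by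
  have hlt : ‖q ^ (n + 1)‖ < 1 := by
    rw [norm_pow]
    exact pow_lt_one₀ (norm_nonneg _) hq n.succ_ne_zero
  rw [pow_succ', h, norm_one] at hlt
  exact lt_irrefl _ hlt

theorem qFin_self_ne_zero (hq : ‖q‖ < 1) (n : ℕ) : qFin q q n ≠ 0 :=
  qFin_ne_zero (self_mul_qpow_ne_one hq) n

theorem qInf_self_ne_zero (hq : ‖q‖ < 1) : qInf q q ≠ 0 :=
  qInf_ne_zero hq (self_mul_qpow_ne_one hq)

theorem tendsto_qpow (hq : ‖q‖ < 1) (x : ℂ) : Tendsto (fun n : ℕ => x * q ^ n) atTop (𝓝 0) := by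
  simpa using (tendsto_pow_atTop_nhds_zero_of_norm_lt_one hq).const_mul x

theorem tendsto_qFin (hq : ‖q‖ < 1) (x : ℂ) : Tendsto (qFin q x) atTop (𝓝 (qInf q x)) :=
  (multipliable_one_sub_mul_qpow hq x).hasProd.tendsto_prod_nat

theorem tendsto_qFins (hq : ‖q‖ < 1) (xs : List ℂ) :
    Tendsto (qFins q xs) atTop (𝓝 (qInfs q xs)) :=
  tendsto_list_prod xs fun x _ => tendsto_qFin hq x

theorem norm_qFin_le (hq : ‖q‖ < 1) (x : ℂ) (n : ℕ) :
    ‖qFin q x n‖ ≤ Real.exp (‖x‖ / (1 - ‖q‖)) := by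
  have hgeom := hasSum_geometric_of_lt_one (norm_nonneg q) hq
  calc ‖qFin q x n‖ = ∏ k ∈ Finset.range n, ‖1 - x * q ^ k‖ := by rw [qFin, norm_prod]
    _ ≤ ∏ k ∈ Finset.range n, Real.exp (‖x‖ * ‖q‖ ^ k) := by
        refine Finset.prod_le_prod (fun _ _ => norm_nonneg _) fun k _ => ?_
        calc ‖1 - x * q ^ k‖ ≤ ‖(1 : ℂ)‖ + ‖x * q ^ k‖ := norm_sub_le _ _
          _ = ‖x‖ * ‖q‖ ^ k + 1 := by rw [norm_one, norm_mul, norm_pow, add_comm]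
          _ ≤ Real.exp (‖x‖ * ‖q‖ ^ k) := Real.add_one_le_exp _
    _ = Real.exp (‖x‖ * ∑ k ∈ Finset.range n, ‖q‖ ^ k) := by
        rw [← Real.exp_sum, Finset.mul_sum]
    _ ≤ Real.exp (‖x‖ / (1 - ‖q‖)) := by
        rw [div_eq_mul_inv]
        gcongr
        exact sum_le_hasSum _ (fun _ _ => by positivity) hgeom

theorem norm_qFins_le (hq : ‖q‖ < 1) (xs : List ℂ) (n : ℕ) :
    ‖qFins q xs n‖ ≤ Real.exp ((xs.map norm).sum / (1 - ‖q‖)) := by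
  induction xs with
  | nil => simp
  | cons x xs ih =>
    rw [qFins_cons, List.map_cons, List.sum_cons, add_div, Real.exp_add, norm_mul]
    gcongr
    exact norm_qFin_le hq x n

theorem norm_qInfs_le (hq : ‖q‖ < 1) (xs : List ℂ) :
    ‖qInfs q xs‖ ≤ Real.exp ((xs.map norm).sum / (1 - ‖q‖)) :=
  le_of_tendsto (tendsto_qFins hq xs).norm (Eventually.of_forall (norm_qFins_le hq xs))

theorem differentiable_qFin (q : ℂ) (n : ℕ) : Differentiable ℂ fun x => qFin q x n := by
  unfold qFin
  fun_prop

theorem differentiable_qInf (hq : ‖q‖ < 1) : Differentiable ℂ (qInf q) := by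
  rw [← differentiableOn_univ]
  have hlim : TendstoLocallyUniformlyOn (fun n x => qFin q x n) (qInf q) atTop Set.univ := by
    rw [tendstoLocallyUniformlyOn_iff_forall_isCompact isOpen_univ]
    intro K _ hK
    obtain ⟨r, hr⟩ := hK.exists_bound_of_continuousOn continuousOn_id
    have h := Summable.hasProdUniformlyOn_nat_one_add hK
      ((summable_geometric_of_lt_one (norm_nonneg q) hq).mul_left r)
      (f := fun n x => -(x * q ^ n)) (Eventually.of_forall fun n x hx => by
        rw [norm_neg, norm_mul, norm_pow]
        gcongr
        exact hr x hx) (fun n => by fun_prop)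
    simp only [← sub_eq_add_neg] at h
    exact h.tendstoUniformlyOn_finsetRange
  exact hlim.differentiableOn
    (Eventually.of_forall fun n => (differentiable_qFin q n).differentiableOn) isOpen_univ

theorem continuous_qInf (hq : ‖q‖ < 1) : Continuous (qInf q) :=
  (differentiable_qInf hq).continuous

theorem tendsto_qInf_mul_qpow (hq : ‖q‖ < 1) (x : ℂ) :
    Tendsto (fun n : ℕ => qInf q (x * q ^ n)) atTop (𝓝 1) := by
  simpa [Function.comp_def] using ((continuous_qInf hq).tendsto 0).comp (tendsto_qpow hq x)

theorem tendsto_qInfs_map_mul_qpow (hq : ‖q‖ < 1) (xs : List ℂ) :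
    Tendsto (fun n : ℕ => qInfs q (xs.map (· * q ^ n))) atTop (𝓝 1) := by
  induction xs with
  | nil => simp
  | cons x xs ih =>
    simpa using (tendsto_qInf_mul_qpow hq x).mul ih

end ShiftedFactorials

section LaurentCoefficients

open Real Metric

theorem circleAverage_comp_mul_right (f : ℂ → ℂ) (u : ℂ) (r : ℝ) :
    circleAverage (fun w => f (w * u)) 0 r = circleAverage f 0 (r * ‖u‖) := by
  have hmap (t : ℝ) : circleMap 0 r t * u = circleMap 0 (r * ‖u‖) (t + u.arg) := by
    nth_rw 1 [← Complex.norm_mul_exp_arg_mul_I u]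
    simp only [circleMap, zero_add, Complex.ofReal_add, Complex.ofReal_mul, add_mul,
      Complex.exp_add]
    ring
  rw [circleAverage_eq_integral_add (f := f) u.arg, circleAverage_def]
  simp only [hmap]

theorem circleAverage_eq_of_differentiableOn {f : ℂ → ℂ} {R r s : ℝ}
    (hf : DifferentiableOn ℂ f (ball 0 R \ {0})) (hr : 0 < r) (hrs : r ≤ s) (hs : s < R) :
    circleAverage f 0 s = circleAverage f 0 r := by
  have hsub : closedBall (0 : ℂ) s \ ball 0 r ⊆ ball 0 R \ {0} := fun w hw =>
    ⟨closedBall_subset_ball hs hw.1, fun h => hw.2 (h ▸ mem_ball_self hr)⟩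
  have hopen : IsOpen (ball (0 : ℂ) R \ {0}) := isOpen_ball.sdiff isClosed_singleton
  rw [circleAverage_eq_circleIntegral (hr.trans_le hrs).ne', circleAverage_eq_circleIntegral hr.ne',
    Complex.circleIntegral_sub_center_inv_smul_eq_of_differentiable_on_annulus_off_countable hr hrs
      Set.countable_empty (hf.continuousOn.mono hsub) fun w hw =>
        hf.differentiableAt (hopen.mem_nhds
          (hsub ⟨ball_subset_closedBall hw.1.1, fun h => hw.1.2 (ball_subset_closedBall h)⟩))]

theorem tendsto_circleAverage_of_norm_le {F : ℕ → ℂ → ℂ} {f : ℂ → ℂ} {r C : ℝ}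
    (hF : ∀ n, ContinuousOn (F n) (sphere 0 |r|)) (hC : ∀ n, ∀ w ∈ sphere 0 |r|, ‖F n w‖ ≤ C)
    (hlim : ∀ w ∈ sphere 0 |r|, Tendsto (F · w) atTop (𝓝 (f w))) :
    Tendsto (fun n => circleAverage (F n) 0 r) atTop (𝓝 (circleAverage f 0 r)) := by
  have hmem (t : ℝ) : circleMap 0 r t ∈ sphere (0 : ℂ) |r| := circleMap_mem_sphere' 0 r t
  refine (intervalIntegral.tendsto_integral_filter_of_dominated_convergence (fun _ => C)
    (.of_forall fun n => ?_) (.of_forall fun n => .of_forall fun t _ => hC n _ (hmem t))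
    intervalIntegrable_const (.of_forall fun t _ => hlim _ (hmem t))).const_smul _
  exact ((hF n).comp_continuous (continuous_circleMap 0 r) hmem).aestronglyMeasurable

theorem hasSum_zpow_mul_circleAverage {f : ℂ → ℂ} {w : ℂ} (hw : w ≠ 0)
    (hf : ContinuousOn f (sphere 0 ‖w‖))
    (hs : Summable fun k : ℤ => w ^ k * circleAverage (fun x => x ^ (-k) * f x) 0 ‖w‖) :
    HasSum (fun k : ℤ => w ^ k * circleAverage (fun x => x ^ (-k) * f x) 0 ‖w‖) (f w) := by
  have : Fact (0 < 2 * π) := ⟨two_pi_pos⟩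
  have hr : (‖w‖ : ℂ) ≠ 0 := by exact_mod_cast norm_ne_zero_iff.2 hw
  let γ (t : AddCircle (2 * π)) : ℂ := ‖w‖ * AddCircle.toCircle t
  have hγ (t : ℝ) : γ t = circleMap 0 ‖w‖ t := by
    simp [γ, AddCircle.toCircle_apply_mk, circleMap, two_pi_pos.ne']
  have hmem (t : AddCircle (2 * π)) : γ t ∈ sphere (0 : ℂ) ‖w‖ := by
    rw [mem_sphere_zero_iff_norm, norm_mul, Circle.norm_coe, mul_one, Complex.norm_real, norm_norm]
  have hmode (n : ℤ) (t : AddCircle (2 * π)) : γ t ^ n = ‖w‖ ^ n * fourier n t := by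
    simp [γ, fourier_apply, AddCircle.toCircle_zsmul, mul_zpow]
  let F : C(AddCircle (2 * π), ℂ) := ⟨fun t => f (γ t), hf.comp_continuous
    (continuous_const.mul (continuous_subtype_val.comp AddCircle.continuous_toCircle)) hmem⟩
  have hcoeff (k : ℤ) :
      fourierCoeff F k = ‖w‖ ^ k * circleAverage (fun x => x ^ (-k) * f x) 0 ‖w‖ := by
    simp only [circleAverage_def, ← hγ, hmode, mul_assoc]
    rw [intervalIntegral.integral_const_mul, fourierCoeff_eq_intervalIntegral F k 0, zero_add,
      mul_smul_comm, ← mul_assoc, zpow_neg, mul_inv_cancel₀ (zpow_ne_zero k hr), one_mul, one_div]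
    rfl
  have hsF : Summable (fourierCoeff F) := by
    refine .of_norm (hs.norm.congr fun k => ?_)
    rw [hcoeff, norm_mul, norm_mul, norm_zpow, norm_zpow, Complex.norm_real, norm_norm]
  obtain ⟨t, ht⟩ : ∃ t : ℝ, γ t = w := by
    obtain ⟨t, ht⟩ : w ∈ Set.range (circleMap 0 ‖w‖) := by simp
    exact ⟨t, (hγ t).trans ht⟩
  have hsum := has_pointwise_sum_fourier_series_of_summable hsF (t : AddCircle (2 * π))
  rw [show F t = f w from congrArg f ht] at hsum
  refine hsum.congr_fun fun k => ?_
  rw [hcoeff, smul_eq_mul, mul_right_comm, ← hmode, ht]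

end LaurentCoefficients

section ThetaFunction

open Real Metric

variable {q : ℂ}

theorem circleAverage_zpow_mul_succ {f : ℂ → ℂ} {p : ℂ} {R r : ℝ} (hq0 : q ≠ 0) (hq : ‖q‖ < 1)
    (hf : DifferentiableOn ℂ f (ball 0 R \ {0}))
    (hfq : ∀ w ∈ ball (0 : ℂ) R \ {0}, f w = (p - w) * f (w * q)) (hr : 0 < r) (hrR : r < R)
    (k : ℤ) :
    circleAverage (fun w => w ^ (k + 1) * f w) 0 r =
      (p * q - q ^ (k + 1)) * circleAverage (fun w => w ^ k * f w) 0 r := by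
  have hle : r * ‖q‖ ≤ r := mul_le_of_le_one_right hr.le hq.le
  have hdiff (j : ℤ) : DifferentiableOn ℂ (fun w => w ^ j * f w) (ball 0 R \ {0}) := fun w hw =>
    (differentiableAt_zpow.2 (.inl hw.2)).differentiableWithinAt.mul (hf w hw)
  have hscale (j : ℤ) : circleAverage (fun w => (w * q) ^ j * f (w * q)) 0 r =
      circleAverage (fun w => w ^ j * f w) 0 r := by
    rw [circleAverage_comp_mul_right (fun w => w ^ j * f w), ← circleAverage_eq_of_differentiableOn
      (hdiff j) (mul_pos hr (norm_pos_iff.2 hq0)) hle hrR]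
  have hmem {w : ℂ} (hw : w ∈ sphere (0 : ℂ) |r|) : w ∈ ball (0 : ℂ) R \ {0} := by
    rw [abs_of_pos hr, mem_sphere_zero_iff_norm] at hw
    exact ⟨by simpa [hw] using hrR, norm_pos_iff.1 (hw ▸ hr)⟩
  have hmemq {w : ℂ} (hw : w ∈ sphere (0 : ℂ) |r|) : w * q ∈ ball (0 : ℂ) R \ {0} := by
    have hw' := hmem hw
    rw [abs_of_pos hr, mem_sphere_zero_iff_norm] at hw
    exact ⟨by simpa [hw] using hle.trans_lt hrR, mul_ne_zero hw'.2 hq0⟩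
  have hint : CircleIntegrable (fun w => w ^ k * f w) 0 r :=
    ((hdiff k).continuousOn.mono fun _ => hmem).circleIntegrable'
  have hintq : CircleIntegrable (fun w => (w * q) ^ k * f (w * q)) 0 r :=
    ((hdiff k).continuousOn.comp (by fun_prop) fun _ => hmemq).circleIntegrable'
  calc circleAverage (fun w => w ^ (k + 1) * f w) 0 r
      = circleAverage (fun w => (w * q) ^ (k + 1) * f (w * q)) 0 r := (hscale _).symm
    _ = circleAverage (fun w => (p * q) • ((w * q) ^ k * f (w * q)) -
          q ^ (k + 1) • (w ^ k * f w)) 0 r := by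
        refine circleAverage_congr_sphere fun w hw => ?_
        simp only [smul_eq_mul]
        rw [hfq w (hmem hw), zpow_add_one₀ (hmemq hw).2, zpow_add_one₀ hq0, mul_zpow]
        ring
    _ = (p * q - q ^ (k + 1)) * circleAverage (fun w => w ^ k * f w) 0 r := by
        rw [circleAverage_fun_sub (hintq.const_fun_smul) (hint.const_fun_smul),
          circleAverage_fun_smul, circleAverage_fun_smul, hscale, smul_eq_mul, smul_eq_mul, sub_mul]

/-- The `k`-th term of the bilateral theta series `∑ (-1)^k q^{k(k-1)/2} x^k`. -/
noncomputable def thetaTerm (q x : ℂ) (k : ℤ) : ℂ :=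
  (-1 : ℂ) ^ k * q ^ (k * (k - 1) / 2) * x ^ k

theorem thetaTerm_succ {x : ℂ} (hq0 : q ≠ 0) (hx : x ≠ 0) (k : ℤ) :
    thetaTerm q x (k + 1) = -x * q ^ k * thetaTerm q x k := by
  have h : (k + 1) * (k + 1 - 1) / 2 = k * (k - 1) / 2 + k := by
    rw [← Int.add_mul_ediv_right _ _ two_ne_zero]
    congr 1
    ring
  rw [thetaTerm, thetaTerm, h, zpow_add₀ hq0, zpow_add_one₀ hx, zpow_add_one₀ (by norm_num)]
  ring

theorem thetaTerm_neg {x : ℂ} (hq0 : q ≠ 0) (k : ℤ) :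
    thetaTerm q x (-k) = thetaTerm q (q / x) k := by
  have h : -k * (-k - 1) / 2 = k * (k - 1) / 2 + k := by
    rw [← Int.add_mul_ediv_right _ _ two_ne_zero]
    congr 1
    ring
  rw [thetaTerm, thetaTerm, h, zpow_add₀ hq0, div_zpow, zpow_neg, zpow_neg, ← inv_zpow, inv_neg_one]
  ring

theorem summable_thetaTerm_natCast (hq0 : q ≠ 0) (hq : ‖q‖ < 1) {x : ℂ} (hx : x ≠ 0) :
    Summable fun n : ℕ => thetaTerm q x n := by
  have hne (n : ℕ) : thetaTerm q x n ≠ 0 :=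
    mul_ne_zero (mul_ne_zero (zpow_ne_zero _ (by norm_num)) (zpow_ne_zero _ hq0))
      (zpow_ne_zero _ hx)
  refine summable_of_ratio_test_tendsto_lt_one zero_lt_one (.of_forall hne)
    (norm_zero (E := ℂ) ▸ (tendsto_qpow hq (-x)).norm |>.congr fun n => ?_)
  rw [Nat.cast_succ, thetaTerm_succ hq0 hx, zpow_natCast, norm_mul (_ * _),
    mul_div_cancel_right₀ _ (norm_ne_zero_iff.2 (hne n))]

theorem summable_thetaTerm (hq0 : q ≠ 0) (hq : ‖q‖ < 1) {x : ℂ} (hx : x ≠ 0) :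
    Summable (thetaTerm q x) := by
  refine .of_nat_of_neg (summable_thetaTerm_natCast hq0 hq hx) ?_
  simp only [thetaTerm_neg hq0]
  exact summable_thetaTerm_natCast hq0 hq (div_ne_zero hq0 hx)

theorem zpow_mul_circleAverage_eq {f : ℂ → ℂ} {R r : ℝ} (hq0 : q ≠ 0) (hq : ‖q‖ < 1)
    (hf : DifferentiableOn ℂ f (ball 0 R \ {0}))
    (hfq : ∀ w ∈ ball (0 : ℂ) R \ {0}, f w = -w * f (w * q)) (hr : 0 < r) (hrR : r < R) {x : ℂ}
    (hx : x ≠ 0) (k : ℤ) :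
    x ^ k * circleAverage (fun w => w ^ (-k) * f w) 0 r =
      circleAverage f 0 r * thetaTerm q x k := by
  have hstep (k : ℤ) : x ^ (k + 1) * circleAverage (fun w => w ^ (-(k + 1)) * f w) 0 r =
      -x * q ^ k * (x ^ k * circleAverage (fun w => w ^ (-k) * f w) 0 r) := by
    have h := circleAverage_zpow_mul_succ (p := 0) hq0 hq hf (by simpa using hfq) hr hrR (-(k + 1))
    rw [show -(k + 1) + 1 = -k by ring] at h
    rw [h, zpow_add_one₀ hx, zpow_neg]
    field_simp
    ring
  induction k with
  | zero => simp [thetaTerm]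
  | succ k ih => rw [hstep, ih, thetaTerm_succ hq0 hx]; ring
  | pred k ih =>
    have hne : -x * q ^ (-(k : ℤ) - 1) ≠ 0 := mul_ne_zero (neg_ne_zero.2 hx) (zpow_ne_zero _ hq0)
    have h := hstep (-k - 1)
    have ht := thetaTerm_succ hq0 hx (-k - 1)
    rw [sub_add_cancel] at h ht
    refine mul_left_cancel₀ hne ?_
    rw [← h, ih, ht]
    ring

theorem eq_circleAverage_mul_tsum_thetaTerm {f : ℂ → ℂ} {R : ℝ} (hq0 : q ≠ 0) (hq : ‖q‖ < 1)
    (hf : DifferentiableOn ℂ f (ball 0 R \ {0}))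
    (hfq : ∀ w ∈ ball (0 : ℂ) R \ {0}, f w = -w * f (w * q)) {w : ℂ}
    (hw : w ∈ ball (0 : ℂ) R \ {0}) :
    f w = circleAverage f 0 ‖w‖ * ∑' k, thetaTerm q w k := by
  have hw0 : w ≠ 0 := hw.2
  have hwR : ‖w‖ < R := by simpa using hw.1
  have hsphere : sphere (0 : ℂ) ‖w‖ ⊆ ball 0 R \ {0} := fun x hx => by
    rw [mem_sphere_zero_iff_norm] at hx
    exact ⟨by simpa [hx] using hwR, norm_pos_iff.1 (hx ▸ norm_pos_iff.2 hw0)⟩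
  have hcoeff := zpow_mul_circleAverage_eq hq0 hq hf hfq (norm_pos_iff.2 hw0) hwR hw0
  have hsum := hasSum_zpow_mul_circleAverage hw0 (hf.continuousOn.mono hsphere)
    (by simpa only [hcoeff] using (summable_thetaTerm hq0 hq hw0).mul_left _)
  simp only [hcoeff] at hsum
  rw [← tsum_mul_left, hsum.tsum_eq]

theorem circleAverage_one_sub_div_mul {f : ℂ → ℂ} {p : ℂ} {R r : ℝ} (hq0 : q ≠ 0) (hq : ‖q‖ < 1)
    (hf : DifferentiableOn ℂ f (ball 0 R \ {0}))
    (hfq : ∀ w ∈ ball (0 : ℂ) R \ {0}, f w = (p - w) * f (w * q)) (hr : 0 < r) (hrR : r < R)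
    (hp : 1 - p * q ≠ 0) :
    circleAverage (fun w => (1 - p * q / w) * f w) 0 r = circleAverage f 0 r / (1 - p * q) := by
  have hrec := circleAverage_zpow_mul_succ hq0 hq hf hfq hr hrR (-1)
  simp only [neg_add_cancel, zpow_zero, one_mul] at hrec
  have hsphere : sphere (0 : ℂ) |r| ⊆ ball 0 R \ {0} := fun w hw => by
    rw [abs_of_pos hr, mem_sphere_zero_iff_norm] at hw
    exact ⟨by simpa [hw] using hrR, norm_pos_iff.1 (hw ▸ hr)⟩
  have hint := hf.continuousOn.mono hsphere
  have hint' : ContinuousOn (fun w => w ^ (-1 : ℤ) * f w) (sphere 0 |r|) := fun w hw =>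
    (continuousAt_zpow₀ w _ (.inl (hsphere hw).2)).continuousWithinAt.mul (hint w hw)
  calc circleAverage (fun w => (1 - p * q / w) * f w) 0 r
      = circleAverage (fun w => f w - (p * q) • (w ^ (-1 : ℤ) * f w)) 0 r := by
        refine circleAverage_congr_sphere fun w _ => ?_
        simp only [smul_eq_mul, zpow_neg_one]
        ring
    _ = circleAverage f 0 r / (1 - p * q) := by
        rw [circleAverage_fun_sub hint.circleIntegrable' hint'.circleIntegrable'.const_fun_smul,
          circleAverage_fun_smul, smul_eq_mul, eq_div_iff hp, hrec]
        ring

theorem circleAverage_qInf_mul_qFin (hq0 : q ≠ 0) (hq : ‖q‖ < 1) {r : ℝ} (hr : 0 < r) (n : ℕ) :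
    circleAverage (fun w => qInf q w * qFin q (q / w) n) 0 r = 1 / qFin q q n := by
  have hdiff (n : ℕ) : DifferentiableOn ℂ (fun w => qInf q w * qFin q (q / w) n)
      (ball 0 (r + 1) \ {0}) := fun w hw =>
    ((differentiable_qInf hq w).mul ((differentiable_qFin q n _).comp w
      ((differentiableAt_const q).div differentiableAt_id hw.2))).differentiableWithinAt
  have hshift (n : ℕ) {w : ℂ} (hw : w ≠ 0) : qInf q w * qFin q (q / w) n =
      (q ^ n - w) * (qInf q (w * q) * qFin q (q / (w * q)) n) := by
    have h := qFin_succ q (1 / w) n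
    rw [qFin_succ', one_div_mul_eq_div] at h
    rw [qInf_eq_mul hq w, div_mul_cancel_right₀ hq0, ← one_div]
    field_simp at h ⊢
    linear_combination -qInf q (w * q) * h
  induction n with
  | zero =>
    simpa using ((differentiable_qInf hq).diffContOnCl (s := ball (0 : ℂ) |r|)).circleAverage
  | succ n ih =>
    have hq1 : 1 - q ^ n * q ≠ 0 := by
      have h := qFin_self_ne_zero hq (n + 1)
      rw [qFin_succ, mul_comm q] at h
      exact right_ne_zero_of_mul h
    have hsucc (w : ℂ) : qInf q w * qFin q (q / w) (n + 1) =
        (1 - q ^ n * q / w) * (qInf q w * qFin q (q / w) n) := by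
      rw [qFin_succ]
      ring
    simp only [hsucc]
    rw [circleAverage_one_sub_div_mul hq0 hq (hdiff n) (fun w hw => hshift n hw.2) hr
      (lt_add_one r) hq1, ih, div_div, qFin_succ q q, mul_comm q]

theorem circleAverage_qInf_mul_qInf (hq0 : q ≠ 0) (hq : ‖q‖ < 1) {r : ℝ} (hr : 0 < r) :
    circleAverage (fun w => qInf q w * qInf q (q / w)) 0 r = 1 / qInf q q := by
  have hdiv : ContinuousOn (fun w => q / w) (sphere 0 |r|) :=
    continuousOn_const.div continuousOn_id fun w hw =>
      ne_of_mem_sphere hw (abs_pos.2 hr.ne').ne'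
  have hlim := tendsto_circleAverage_of_norm_le (r := r) (f := fun w => qInf q w * qInf q (q / w))
    (F := fun n w => qInf q w * qFin q (q / w) n)
    (C := Real.exp (r / (1 - ‖q‖)) * Real.exp (‖q‖ / r / (1 - ‖q‖)))
    (fun n => (continuous_qInf hq).continuousOn.mul
      ((differentiable_qFin q n).continuous.comp_continuousOn hdiv)) (fun n w hw => ?_)
    fun w _ => (tendsto_qFin hq (q / w)).const_mul _
  · simp only [circleAverage_qInf_mul_qFin hq0 hq hr] at hlim
    exact tendsto_nhds_unique hlim
      (tendsto_const_nhds.div (tendsto_qFin hq q) (qInf_self_ne_zero hq))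
  · rw [mem_sphere_zero_iff_norm, abs_of_pos hr] at hw
    rw [norm_mul]
    gcongr
    · simpa [hw] using norm_qInfs_le hq [w]
    · simpa [hw] using norm_qFin_le hq (q / w) n

theorem theta_eq_qInf_mul_qInf {x : ℂ} (hq0 : q ≠ 0) (hq : ‖q‖ < 1) (hx : x ≠ 0) :
    theta q x = qInf q x * qInf q (q / x) := by
  have hdiff : DifferentiableOn ℂ (fun w => qInf q w * qInf q (q / w)) (ball 0 (‖x‖ + 1) \ {0}) :=
    fun w hw => ((differentiable_qInf hq w).mul ((differentiable_qInf hq _).comp w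
      ((differentiableAt_const q).div differentiableAt_id hw.2))).differentiableWithinAt
  have hshift (w : ℂ) (hw : w ∈ ball (0 : ℂ) (‖x‖ + 1) \ {0}) : qInf q w * qInf q (q / w) =
      -w * (qInf q (w * q) * qInf q (q / (w * q))) := by
    have hw0 : w ≠ 0 := hw.2
    rw [qInf_eq_mul hq w, div_mul_cancel_right₀ hq0, qInf_eq_mul hq w⁻¹, inv_mul_eq_div]
    field_simp
    ring
  rw [eq_circleAverage_mul_tsum_thetaTerm hq0 hq hdiff hshift (w := x) ⟨by simp, hx⟩,
    circleAverage_qInf_mul_qInf hq0 hq (norm_pos_iff.2 hx)]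
  rfl

theorem theta_ne_zero {x : ℂ} (hq0 : q ≠ 0) (hq : ‖q‖ < 1) (hx0 : x ≠ 0)
    (hx : ∀ n : ℤ, x ≠ q ^ n) : theta q x ≠ 0 := by
  rw [theta_eq_qInf_mul_qInf hq0 hq hx0]
  refine mul_ne_zero (qInf_ne_zero hq fun n h => hx (-n) ?_)
    (qInf_ne_zero hq fun n h => hx (n + 1) ?_)
  · rw [zpow_neg, zpow_natCast]
    exact eq_inv_of_mul_eq_one_left h
  · rw [div_mul_eq_mul_div, div_eq_one_iff_eq hx0, ← pow_succ'] at h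
    exact_mod_cast h.symm

theorem eqOn_zero_of_theta_ne_zero {f : ℂ → ℂ} {R : ℝ} (hq0 : q ≠ 0) (hq : ‖q‖ < 1)
    (hf : DifferentiableOn ℂ f (ball 0 R \ {0}))
    (hfq : ∀ w ∈ ball (0 : ℂ) R \ {0}, f w = -w * f (w * q)) {b : ℂ}
    (hb : b ∈ ball (0 : ℂ) R \ {0}) (hfb : f b = 0) (hθ : theta q b ≠ 0) :
    Set.EqOn f 0 (ball 0 R \ {0}) := by
  intro w hw
  have hexpand {w : ℂ} (hw : w ∈ ball (0 : ℂ) R \ {0}) :=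
    eq_circleAverage_mul_tsum_thetaTerm hq0 hq hf hfq hw
  have havg : circleAverage f 0 ‖w‖ = circleAverage f 0 ‖b‖ := by
    have hw' : 0 < ‖w‖ ∧ ‖w‖ < R := ⟨norm_pos_iff.2 hw.2, by simpa using hw.1⟩
    have hb' : 0 < ‖b‖ ∧ ‖b‖ < R := ⟨norm_pos_iff.2 hb.2, by simpa using hb.1⟩
    rcases le_total ‖b‖ ‖w‖ with h | h
    · exact circleAverage_eq_of_differentiableOn hf hb'.1 h hw'.2
    · exact (circleAverage_eq_of_differentiableOn hf hw'.1 h hb'.2).symm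
  have hb0 : circleAverage f 0 ‖b‖ = 0 :=
    (mul_eq_zero.1 ((hexpand hb).symm.trans hfb)).resolve_right (right_ne_zero_of_mul hθ)
  rw [hexpand hw, havg, hb0, zero_mul]
  rfl

end ThetaFunction

section RegularisedSeries

variable {q : ℂ}

theorem differentiableOn_tsum_of_norm_le_geometric {U : Set ℂ} (hU : IsOpen U) {F : ℕ → ℂ → ℂ}
    {C : ℂ → ℝ} {Z : ℂ → ℂ} (hF : ∀ n, DifferentiableOn ℂ (F n) U) (hC : ContinuousOn C U)
    (hZ : ContinuousOn Z U) (hZ1 : ∀ w ∈ U, ‖Z w‖ < 1)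
    (hle : ∀ n, ∀ w ∈ U, ‖F n w‖ ≤ C w * ‖Z w‖ ^ n) :
    DifferentiableOn ℂ (fun w => ∑' n, F n w) U := by
  intro w₀ hw₀
  obtain ⟨ρ, hρ, hρ1⟩ := exists_between (hZ1 w₀ hw₀)
  have hU₀ := hU.mem_nhds hw₀
  have hbound : ∀ᶠ w in 𝓝 w₀, w ∈ U ∧ C w < |C w₀| + 1 ∧ ‖Z w‖ < ρ :=
    (eventually_mem_set.2 hU₀).and
      (((hC.continuousAt hU₀).eventually_lt_const (by linarith [le_abs_self (C w₀)])).and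
        ((hZ.continuousAt hU₀).norm.eventually_lt_const hρ))
  obtain ⟨V, hV, hVopen, hw₀V⟩ := eventually_nhds_iff.1 hbound
  have hρ0 : 0 ≤ ρ := (norm_nonneg _).trans hρ.le
  have hdiff := Complex.differentiableOn_tsum_of_summable_norm
    ((summable_geometric_of_lt_one hρ0 hρ1).mul_left (|C w₀| + 1))
    (fun n => (hF n).mono fun w hw => (hV w hw).1) hVopen fun n w hw => by
      obtain ⟨hwU, hCw, hZw⟩ := hV w hw
      refine (hle n w hwU).trans ?_
      gcongr
  exact (hdiff.differentiableAt (hVopen.mem_nhds hw₀V)).differentiableWithinAt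

/-- The lower parameters `aq/a₄, …, aq/a_{r+1}` of `_{r+1}W_r[a; a₄, …, a_{r+1}; q, z]`, preceded
by the parameter `q` which produces the factor `(q; q)_n` in the denominator of its terms. -/
noncomputable def WLower (a : ℂ) (l : List ℂ) (q : ℂ) : List ℂ := q :: l.map (fun x => a * q / x)

/-- The `n`-th term of `_{r+1}W_r[a; a₄, …, a_{r+1}; q, z]` multiplied by
`(q, aq/a₄, …, aq/a_{r+1}; q)_∞`: each quotient `(b; q)_∞ / (b; q)_n` is written `(b q^n; q)_∞`, so
that no denominator is left. -/
noncomputable def WRegTerm (a : ℂ) (l : List ℂ) (q z : ℂ) (n : ℕ) : ℂ :=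
  vwpFactor q a n * qFins q l n * qInfs q ((WLower a l q).map (· * q ^ n)) * z ^ n

/-- The regularised very-well-poised series: `_{r+1}W_r[a; a₄, …, a_{r+1}; q, z]` multiplied by
`(q, aq/a₄, …, aq/a_{r+1}; q)_∞`. Unlike `W` it is holomorphic in the parameters across the zeros
of the denominators. -/
noncomputable def WReg (a : ℂ) (l : List ℂ) (q z : ℂ) : ℂ := ∑' n : ℕ, WRegTerm a l q z n

theorem qFins_mul_qInfs (hq : ‖q‖ < 1) (xs : List ℂ) (n : ℕ) :
    qFins q xs n * qInfs q (xs.map (· * q ^ n)) = qInfs q xs := by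
  induction xs with
  | nil => simp
  | cons x xs ih =>
    rw [List.map_cons, qFins_cons, qInfs_cons, qInfs_cons, ← ih, ← qFin_mul_qInf hq x n]
    ring

theorem qInfs_ne_zero (hq : ‖q‖ < 1) {xs : List ℂ} (h : ∀ x ∈ xs, ∀ n : ℕ, x * q ^ n ≠ 1) :
    qInfs q xs ≠ 0 := by
  simpa [qInfs] using fun x hx => qInf_ne_zero hq (h x hx)

theorem qFins_ne_zero {xs : List ℂ} (h : ∀ x ∈ xs, ∀ n : ℕ, x * q ^ n ≠ 1) (n : ℕ) :
    qFins q xs n ≠ 0 := by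
  simpa [qFins] using fun x hx => qFin_ne_zero (h x hx) n

theorem WTerm_eq_div (a : ℂ) (l : List ℂ) (q z : ℂ) (n : ℕ) :
    WTerm a l q z n = vwpFactor q a n * qFins q l n / qFins q (WLower a l q) n * z ^ n := by
  rw [WTerm, WLower, qFins_cons]
  ring

theorem WTerm_eq_WRegTerm_div (hq : ‖q‖ < 1) {a : ℂ} {l : List ℂ}
    (h : ∀ x ∈ WLower a l q, ∀ n : ℕ, x * q ^ n ≠ 1) (z : ℂ) (n : ℕ) :
    WTerm a l q z n = WRegTerm a l q z n / qInfs q (WLower a l q) := by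
  have hfin := qFins_ne_zero h n
  have hinf := qInfs_ne_zero hq h
  rw [WTerm_eq_div, WRegTerm, eq_div_iff hinf, div_mul_eq_mul_div, div_mul_eq_mul_div,
    div_eq_iff hfin, ← qFins_mul_qInfs hq (WLower a l q) n]
  ring

theorem W_eq_WReg_div (hq : ‖q‖ < 1) {a : ℂ} {l : List ℂ}
    (h : ∀ x ∈ WLower a l q, ∀ n : ℕ, x * q ^ n ≠ 1) (z : ℂ) :
    W a l q z = WReg a l q z / qInfs q (WLower a l q) := by
  rw [W, tsum_congr (WTerm_eq_WRegTerm_div hq h z), tsum_div_const, WReg]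

theorem norm_vwpFactor_le (hq : ‖q‖ < 1) (a : ℂ) (n : ℕ) :
    ‖vwpFactor q a n‖ ≤ (1 + ‖a‖) * Real.exp (‖a‖ / (1 - ‖q‖)) := by
  have := sub_pos.2 hq
  cases n with
  | zero =>
    rw [vwpFactor, norm_one]
    exact one_le_mul_of_one_le_of_one_le (by simp) (Real.one_le_exp (by positivity))
  | succ n =>
    have hfactor : ‖1 - a * q ^ (2 * (n + 1))‖ ≤ 1 + ‖a‖ := by
      refine (norm_sub_le _ _).trans ?_
      rw [norm_one, norm_mul, norm_pow]
      gcongr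
      exact mul_le_of_le_one_right (norm_nonneg _) (pow_le_one₀ (norm_nonneg _) hq.le)
    rw [vwpFactor, norm_mul]
    refine mul_le_mul hfactor ((norm_qFin_le hq _ n).trans ?_) (norm_nonneg _) (by positivity)
    rw [norm_mul]
    gcongr
    exact mul_le_of_le_one_right (norm_nonneg _) hq.le

theorem norm_qInfs_map_mul_qpow_le (hq : ‖q‖ < 1) (xs : List ℂ) (n : ℕ) :
    ‖qInfs q (xs.map (· * q ^ n))‖ ≤ Real.exp ((xs.map norm).sum / (1 - ‖q‖)) := by
  have := sub_pos.2 hq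
  refine (norm_qInfs_le hq _).trans ?_
  gcongr
  rw [List.map_map]
  refine List.sum_le_sum fun x _ => ?_
  rw [Function.comp_apply, norm_mul, norm_pow]
  exact mul_le_of_le_one_right (norm_nonneg _) (pow_le_one₀ (norm_nonneg _) hq.le)

/-- A bound for the coefficients of `z ^ n` in the terms of the regularised series `WReg a l q z`,
uniform in `n` and continuous in the parameters. -/
noncomputable def WRegBound (a : ℂ) (l : List ℂ) (q : ℂ) : ℝ :=
  (1 + ‖a‖) * Real.exp (‖a‖ / (1 - ‖q‖)) * Real.exp ((l.map norm).sum / (1 - ‖q‖)) *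
    Real.exp (((WLower a l q).map norm).sum / (1 - ‖q‖))

theorem norm_WRegTerm_le (hq : ‖q‖ < 1) (a : ℂ) (l : List ℂ) (z : ℂ) (n : ℕ) :
    ‖WRegTerm a l q z n‖ ≤ WRegBound a l q * ‖z‖ ^ n := by
  rw [WRegTerm, WRegBound, norm_mul, norm_mul, norm_mul, norm_pow]
  gcongr
  · exact norm_vwpFactor_le hq a n
  · exact norm_qFins_le hq l n
  · exact norm_qInfs_map_mul_qpow_le hq _ n

theorem summable_WRegTerm (hq : ‖q‖ < 1) (a : ℂ) (l : List ℂ) {z : ℂ} (hz : ‖z‖ < 1) :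
    Summable (WRegTerm a l q z) :=
  .of_norm_bounded ((summable_geometric_of_lt_one (norm_nonneg z) hz).mul_left _)
    (norm_WRegTerm_le hq a l z)

theorem summable_WTerm (hq : ‖q‖ < 1) {a : ℂ} {l : List ℂ}
    (h : ∀ x ∈ WLower a l q, ∀ n : ℕ, x * q ^ n ≠ 1) {z : ℂ} (hz : ‖z‖ < 1) :
    Summable (WTerm a l q z) :=
  ((summable_WRegTerm hq a l hz).div_const _).congr fun n => (WTerm_eq_WRegTerm_div hq h z n).symm

section Holomorphy

variable {U : Set ℂ} {fs : List (ℂ → ℂ)}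

theorem differentiableOn_qFins_map (hfs : ∀ f ∈ fs, DifferentiableOn ℂ f U) (n : ℕ) :
    DifferentiableOn ℂ (fun w => qFins q (fs.map (· w)) n) U := by
  induction fs with
  | nil => simp
  | cons f fs ih =>
    simp only [List.map_cons, qFins_cons]
    exact ((differentiable_qFin q n).comp_differentiableOn (hfs f List.mem_cons_self)).mul
      (ih fun g hg => hfs g (List.mem_cons_of_mem f hg))

theorem differentiableOn_qInfs_map (hq : ‖q‖ < 1) (hfs : ∀ f ∈ fs, DifferentiableOn ℂ f U) :
    DifferentiableOn ℂ (fun w => qInfs q (fs.map (· w))) U := by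
  induction fs with
  | nil => simp
  | cons f fs ih =>
    simp only [List.map_cons, qInfs_cons]
    exact ((differentiable_qInf hq).comp_differentiableOn (hfs f List.mem_cons_self)).mul
      (ih fun g hg => hfs g (List.mem_cons_of_mem f hg))

theorem continuousOn_sum_norm_map (hfs : ∀ f ∈ fs, ContinuousOn f U) :
    ContinuousOn (fun w => ((fs.map (· w)).map norm).sum) U := by
  simpa only [List.map_map, Function.comp_def] using
    continuousOn_list_sum fs fun f hf => (hfs f hf).norm

theorem differentiableOn_vwpFactor {A : ℂ → ℂ} (hA : DifferentiableOn ℂ A U) (n : ℕ) :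
    DifferentiableOn ℂ (fun w => vwpFactor q (A w) n) U := by
  cases n with
  | zero => simp only [vwpFactor, differentiableOn_const]
  | succ n =>
    simp only [vwpFactor]
    exact ((differentiableOn_const 1).sub (hA.mul_const _)).mul
      ((differentiable_qFin q n).comp_differentiableOn (hA.mul_const q))

theorem WLower_map (A : ℂ → ℂ) (fs : List (ℂ → ℂ)) (q w : ℂ) : WLower (A w) (fs.map (· w)) q =
    ((fun _ => q) :: fs.map fun f w => A w * q / f w).map (· w) := by
  simp [WLower]

theorem differentiableOn_of_mem_WLower {A : ℂ → ℂ} (hA : DifferentiableOn ℂ A U)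
    (hfs : ∀ f ∈ fs, DifferentiableOn ℂ f U) (hfs0 : ∀ f ∈ fs, ∀ w ∈ U, f w ≠ 0) :
    ∀ g ∈ (fun _ => q) :: fs.map fun f w => A w * q / f w, DifferentiableOn ℂ g U := by
  simp only [List.mem_cons, List.mem_map]
  rintro _ (rfl | ⟨f, hf, rfl⟩)
  · exact differentiableOn_const q
  · exact (hA.mul_const q).div (hfs f hf) (hfs0 f hf)

theorem differentiableOn_WRegTerm (hq : ‖q‖ < 1) {A Z : ℂ → ℂ} (hA : DifferentiableOn ℂ A U)
    (hfs : ∀ f ∈ fs, DifferentiableOn ℂ f U) (hfs0 : ∀ f ∈ fs, ∀ w ∈ U, f w ≠ 0)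
    (hZ : DifferentiableOn ℂ Z U) (n : ℕ) :
    DifferentiableOn ℂ (fun w => WRegTerm (A w) (fs.map (· w)) q (Z w) n) U := by
  have hinfs : DifferentiableOn ℂ
      (fun w => qInfs q ((WLower (A w) (fs.map (· w)) q).map (· * q ^ n))) U := by
    simpa only [WLower_map, List.map_map, Function.comp_def] using
      differentiableOn_qInfs_map hq (fs := ((fun _ => q) :: fs.map fun f w => A w * q / f w).map
        fun g w => g w * q ^ n) fun g hg => by
          obtain ⟨f, hf, rfl⟩ := List.mem_map.1 hg
          exact (differentiableOn_of_mem_WLower hA hfs hfs0 f hf).mul_const _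
  exact (((differentiableOn_vwpFactor hA n).mul (differentiableOn_qFins_map hfs n)).mul
    hinfs).mul (hZ.pow n)

theorem continuousOn_WRegBound {A : ℂ → ℂ} (hA : DifferentiableOn ℂ A U)
    (hfs : ∀ f ∈ fs, DifferentiableOn ℂ f U) (hfs0 : ∀ f ∈ fs, ∀ w ∈ U, f w ≠ 0) :
    ContinuousOn (fun w => WRegBound (A w) (fs.map (· w)) q) U := by
  have hupper := continuousOn_sum_norm_map fun f hf => (hfs f hf).continuousOn
  have hlower : ContinuousOn (fun w => ((WLower (A w) (fs.map (· w)) q).map norm).sum) U := by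
    simpa only [WLower_map] using continuousOn_sum_norm_map fun f hf =>
      (differentiableOn_of_mem_WLower hA hfs hfs0 f hf).continuousOn
  exact (((continuousOn_const.add hA.continuousOn.norm).mul
    (hA.continuousOn.norm.div_const _).rexp).mul (hupper.div_const _).rexp).mul
    (hlower.div_const _).rexp

theorem differentiableOn_WReg (hq : ‖q‖ < 1) (hU : IsOpen U) {A Z : ℂ → ℂ}
    (hA : DifferentiableOn ℂ A U) (hfs : ∀ f ∈ fs, DifferentiableOn ℂ f U)
    (hfs0 : ∀ f ∈ fs, ∀ w ∈ U, f w ≠ 0) (hZ : DifferentiableOn ℂ Z U)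
    (hZ1 : ∀ w ∈ U, ‖Z w‖ < 1) :
    DifferentiableOn ℂ (fun w => WReg (A w) (fs.map (· w)) q (Z w)) U :=
  differentiableOn_tsum_of_norm_le_geometric hU (differentiableOn_WRegTerm hq hA hfs hfs0 hZ)
    (continuousOn_WRegBound hA hfs hfs0) hZ.continuousOn hZ1
    fun n _ _ => norm_WRegTerm_le hq _ _ _ n

end Holomorphy

end RegularisedSeries

section Telescoping

variable {q : ℂ}

theorem tsum_eq_of_telescoping {t H : ℕ → ℂ} {L : ℂ} (ht : Summable t) (h0 : t 0 = H 0)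
    (hs : ∀ n, t (n + 1) = H (n + 1) - H n) (hL : Tendsto H atTop (𝓝 L)) : ∑' n, t n = L := by
  have hsum : ∀ n, ∑ k ∈ Finset.range (n + 1), t k = H n := by
    intro n
    induction n with
    | zero => simpa using h0
    | succ n ih => rw [Finset.sum_range_succ, ih, hs]; ring
  refine tendsto_nhds_unique ((tendsto_add_atTop_iff_nat 1).2 ht.hasSum.tendsto_sum_nat) ?_
  simpa only [hsum] using hL

theorem qInf_eq_qFin_succ_mul (hq : ‖q‖ < 1) (x : ℂ) (n : ℕ) :
    qInf q x = qFin q x (n + 1) * ((1 - x * q ^ (n + 1)) * qInf q (x * q * q ^ (n + 1))) := by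
  rw [← qFin_mul_qInf hq x (n + 1), qInf_mul_qpow hq, mul_assoc x, ← pow_succ']

theorem qFins_succ (q : ℂ) (xs : List ℂ) (n : ℕ) :
    qFins q xs (n + 1) = qFins q xs n * (xs.map (1 - · * q ^ n)).prod := by
  simp only [qFins, qFin_succ, List.prod_map_mul]

theorem qInfs_map_mul_qpow (hq : ‖q‖ < 1) (xs : List ℂ) (n : ℕ) :
    qInfs q (xs.map (· * q ^ n)) =
      (xs.map (1 - · * q ^ n)).prod * qInfs q (xs.map (· * q ^ (n + 1))) := by
  simp only [qInfs, List.map_map, Function.comp_def, qInf_mul_qpow hq _ n, List.prod_map_mul]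

theorem vwpFactor_succ (q a : ℂ) (n : ℕ) :
    vwpFactor q a (n + 1) = (1 - a * (q ^ (n + 1)) ^ 2) * qFin q (a * q) n := by
  rw [vwpFactor, ← pow_mul, mul_comm (n + 1) 2]

theorem one_sub_mul_vwpFactor_succ (q a : ℂ) (n : ℕ) :
    (1 - a * q) * vwpFactor q (a * q) (n + 1) =
      (1 - a * q * (q ^ (n + 1)) ^ 2) * (1 - a * q ^ (n + 1)) * qFin q (a * q) n := by
  have h := (qFin_succ' q (a * q) n).symm.trans (qFin_succ q (a * q) n)
  rw [vwpFactor_succ]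
  linear_combination (1 - a * q * (q ^ (n + 1)) ^ 2) * h

theorem eq_qInfs_mul_of_eq_prod_mul (hq : ‖q‖ < 1) {xs : List ℂ} {f : ℂ → ℂ} {S : Set ℂ}
    (hS : ∀ a ∈ S, a * q ∈ S) (hf : ∀ a ∈ S, f a = (xs.map (1 - · * a)).prod * f (a * q))
    (hcont : ContinuousAt f 0) {a : ℂ} (ha : a ∈ S) : f a = qInfs q (xs.map (· * a)) * f 0 := by
  have hmem : ∀ n : ℕ, a * q ^ n ∈ S := by
    intro n
    induction n with
    | zero => simpa using ha
    | succ n ih => simpa only [pow_succ, mul_assoc] using hS _ ih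
  have hiter : ∀ n : ℕ, f a = qFins q (xs.map (· * a)) n * f (a * q ^ n) := by
    intro n
    induction n with
    | zero => simp [qFins, qFin_zero, Function.comp_def]
    | succ n ih =>
      rw [ih, hf _ (hmem n), qFins_succ, List.map_map]
      simp only [Function.comp_def, pow_succ, mul_assoc]
  exact tendsto_nhds_unique (tendsto_const_nhds.congr hiter)
    ((tendsto_qFins hq _).mul (hcont.tendsto.comp (tendsto_qpow hq a)))

theorem norm_mul_div_lt_one (hq : ‖q‖ < 1) {a z : ℂ} (ha : ‖a / z‖ < 1) : ‖a * q / z‖ < 1 := by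
  rw [mul_div_right_comm, norm_mul]
  exact mul_lt_one_of_nonneg_of_lt_one_left (norm_nonneg _) ha hq.le

end Telescoping

section SixPhiFive

variable {q c d e z : ℂ}

theorem prod_one_sub_mul (hz : z * q = c * d * e) (t : ℂ) :
    (1 - c * t) * (1 - d * t) * (1 - e * t) =
      1 - (c + d + e) * t + (c * d + c * e + d * e) * t ^ 2 - z * q * t ^ 3 := by
  rw [hz]
  ring

theorem prod_one_sub_div (hc : c ≠ 0) (hd : d ≠ 0) (he : e ≠ 0) (hz : z * q = c * d * e) (t : ℂ) :
    (1 - t / c) * (1 - t / d) * (1 - t / e) =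
      1 - (c * d + c * e + d * e) * t / (z * q) + (c + d + e) * t ^ 2 / (z * q) -
        t ^ 3 / (z * q) := by
  rw [hz]
  field_simp
  ring

/-- The very-well-poised `₆φ₅` series `₆W₅[a; c, d, e; q, a/z]`, regularised as in `WReg`. -/
noncomputable def sixSum (q c d e z a : ℂ) : ℂ := WReg a [c, d, e] q (a / z)

/-- The common factor of the terms of index `n + 1` of the series `sixSum q c d e z a` and
`sixSum q c d e z (a * q)` and of the certificate `sixCert`. -/
noncomputable def sixFactor (q c d e z a : ℂ) (n : ℕ) : ℂ :=
  qFin q (a * q) n * qFins q [c, d, e] (n + 1) *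
    qInfs q ([a * q / c, a * q / d, a * q / e].map (· * q ^ (n + 2))) * qInf q (q * q ^ (n + 1)) *
    (a / z) ^ (n + 1)

/-- The telescoping certificate for the contiguous relation of `sixSum`: the sequence whose
differences are the terms of the relation. -/
noncomputable def sixCert (q c d e z a : ℂ) (n : ℕ) : ℂ :=
  -(qFin q (a * q) n * qFins q [c, d, e] (n + 1) *
    qInfs q ([a * q / c, a * q / d, a * q / e].map (· * q ^ (n + 1))) * qInf q (q * q ^ n) *
    (1 - a ^ 2 * q ^ (n + 1) / z)) * (a / z) ^ (n + 1)

theorem tendsto_sixCert (hq : ‖q‖ < 1) {a : ℂ} (ha : ‖a / z‖ < 1) :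
    Tendsto (sixCert q c d e z a) atTop (𝓝 0) := by
  have hpow : Tendsto (fun n : ℕ => (a / z) ^ (n + 1)) atTop (𝓝 0) :=
    (tendsto_add_atTop_iff_nat 1).2 (tendsto_pow_atTop_nhds_zero_of_norm_lt_one ha)
  have hqpow : Tendsto (fun n : ℕ => 1 - a ^ 2 * q ^ (n + 1) / z) atTop (𝓝 (1 - 0 / z)) :=
    (((tendsto_add_atTop_iff_nat 1).2 (tendsto_qpow hq (a ^ 2))).div_const z).const_sub 1
  have hfins := (tendsto_add_atTop_iff_nat 1).2 (tendsto_qFins hq [c, d, e])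
  have hinfs := (tendsto_add_atTop_iff_nat 1).2
    (tendsto_qInfs_map_mul_qpow hq [a * q / c, a * q / d, a * q / e])
  have hinf := tendsto_qInf_mul_qpow hq q
  have hcert :=
    (((((tendsto_qFin hq (a * q)).mul hfins).mul hinfs).mul hinf).mul hqpow).neg.mul hpow
  rw [mul_zero] at hcert
  exact hcert

theorem sixTerm_succ (hq : ‖q‖ < 1) (a : ℂ) (n : ℕ) :
    WRegTerm a [c, d, e] q (a / z) (n + 1) =
      sixFactor q c d e z a n * ((1 - a * (q ^ (n + 1)) ^ 2) * ((1 - a * q / c * q ^ (n + 1)) *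
        (1 - a * q / d * q ^ (n + 1)) * (1 - a * q / e * q ^ (n + 1)))) := by
  rw [WRegTerm, vwpFactor_succ, WLower, List.map_cons, qInfs_cons, qInfs_map_mul_qpow hq, sixFactor]
  simp only [List.map_cons, List.map_nil, List.prod_cons, List.prod_nil]
  ring

theorem sixTerm_shift_succ (a : ℂ) (n : ℕ) :
    (1 - a * q) * WRegTerm (a * q) [c, d, e] q (a * q / z) (n + 1) =
      sixFactor q c d e z a n *
        ((1 - a * q * (q ^ (n + 1)) ^ 2) * (1 - a * q ^ (n + 1)) * q ^ (n + 1)) := by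
  have hv := one_sub_mul_vwpFactor_succ q a n
  have hpow : (a * q / z) ^ (n + 1) = (a / z) ^ (n + 1) * q ^ (n + 1) := by rw [← mul_pow]; ring
  have hshift : ∀ w, a * q * q / w * q ^ (n + 1) = a * q / w * q ^ (n + 2) := fun w => by ring
  simp only [WRegTerm, WLower, sixFactor, List.map_cons, List.map_nil, qInfs_cons, qInfs_nil,
    hshift, hpow]
  linear_combination qFins q [c, d, e] (n + 1) * qInf q (q * q ^ (n + 1)) *
    (qInf q (a * q / c * q ^ (n + 2)) * qInf q (a * q / d * q ^ (n + 2)) *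
      qInf q (a * q / e * q ^ (n + 2))) * ((a / z) ^ (n + 1) * q ^ (n + 1)) * hv

theorem sixCert_succ (a : ℂ) (n : ℕ) :
    sixCert q c d e z a (n + 1) =
      -(sixFactor q c d e z a n * ((1 - a * q ^ (n + 1)) *
        ((1 - c * q ^ (n + 1)) * (1 - d * q ^ (n + 1)) * (1 - e * q ^ (n + 1))) * (a / z) *
        (1 - a ^ 2 * (q * q ^ (n + 1)) / z))) := by
  rw [sixCert, sixFactor, qFins_succ q _ (n + 1), qFin_succ]
  simp only [List.map_cons, List.map_nil, List.prod_cons, List.prod_nil]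
  ring

theorem sixCert_eq (hq : ‖q‖ < 1) (a : ℂ) (n : ℕ) :
    sixCert q c d e z a n =
      -(sixFactor q c d e z a n * ((1 - q ^ (n + 1)) * (1 - a ^ 2 * q ^ (n + 1) / z) *
        ((1 - a * q / c * q ^ (n + 1)) * (1 - a * q / d * q ^ (n + 1)) *
          (1 - a * q / e * q ^ (n + 1))))) := by
  rw [sixCert, sixFactor, qInfs_map_mul_qpow hq, qInf_mul_qpow hq]
  simp only [List.map_cons, List.map_nil, List.prod_cons, List.prod_nil]
  ring

theorem sixSum_certificate_succ (hq0 : q ≠ 0) (hz0 : z ≠ 0) (hc : c ≠ 0) (hd : d ≠ 0)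
    (he : e ≠ 0) (hz : z * q = c * d * e) (a x : ℂ) :
    (1 - a / z) * ((1 - a * x ^ 2) *
        ((1 - a * q * x / c) * (1 - a * q * x / d) * (1 - a * q * x / e))) -
      (1 - c * (a / z)) * (1 - d * (a / z)) * (1 - e * (a / z)) *
        ((1 - a * q * x ^ 2) * (1 - a * x) * x) =
    (1 - x) * (1 - a ^ 2 * x / z) *
        ((1 - a * q * x / c) * (1 - a * q * x / d) * (1 - a * q * x / e)) -
      (1 - a * x) * ((1 - c * x) * (1 - d * x) * (1 - e * x)) * (a / z) *
        (1 - a ^ 2 * (q * x) / z) := by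
  simp only [prod_one_sub_mul hz, prod_one_sub_div hc hd he hz]
  field_simp
  ring

theorem sixSum_certificate_zero (hq0 : q ≠ 0) (hz0 : z ≠ 0) (hc : c ≠ 0) (hd : d ≠ 0)
    (he : e ≠ 0) (hz : z * q = c * d * e) (a : ℂ) :
    (1 - a / z) * ((1 - a * q / c) * (1 - a * q / d) * (1 - a * q / e)) -
      (1 - c * (a / z)) * (1 - d * (a / z)) * (1 - e * (a / z)) * (1 - a * q) =
    -((1 - c) * (1 - d) * (1 - e)) * (a / z) * (1 - a ^ 2 * q / z) := by
  have hone := prod_one_sub_mul hz 1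
  simp only [mul_one] at hone
  rw [prod_one_sub_mul hz, prod_one_sub_div hc hd he hz, hone]
  field_simp
  ring

theorem sixSum_step (hq0 : q ≠ 0) (hq : ‖q‖ < 1) (hz0 : z ≠ 0) (hc : c ≠ 0) (hd : d ≠ 0)
    (he : e ≠ 0) (hz : z * q = c * d * e) (a : ℂ) (n : ℕ) :
    (1 - a / z) * WRegTerm a [c, d, e] q (a / z) (n + 1) -
      (1 - a * q) * ((1 - c * (a / z)) * (1 - d * (a / z)) * (1 - e * (a / z))) *
        WRegTerm (a * q) [c, d, e] q (a * q / z) (n + 1) =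
      sixCert q c d e z a (n + 1) - sixCert q c d e z a n := by
  have hcertificate := sixSum_certificate_succ hq0 hz0 hc hd he hz a (q ^ (n + 1))
  have hshift := sixTerm_shift_succ (q := q) (c := c) (d := d) (e := e) (z := z) a n
  rw [sixTerm_succ hq, sixCert_succ, sixCert_eq hq]
  linear_combination sixFactor q c d e z a n * hcertificate -
    (1 - c * (a / z)) * (1 - d * (a / z)) * (1 - e * (a / z)) * hshift

theorem sixSum_step_zero (hq0 : q ≠ 0) (hq : ‖q‖ < 1) (hz0 : z ≠ 0) (hc : c ≠ 0) (hd : d ≠ 0)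
    (he : e ≠ 0) (hz : z * q = c * d * e) (a : ℂ) :
    (1 - a / z) * WRegTerm a [c, d, e] q (a / z) 0 -
      (1 - a * q) * ((1 - c * (a / z)) * (1 - d * (a / z)) * (1 - e * (a / z))) *
        WRegTerm (a * q) [c, d, e] q (a * q / z) 0 = sixCert q c d e z a 0 := by
  have hcertificate := sixSum_certificate_zero hq0 hz0 hc hd he hz a
  have hshift : ∀ w, a * q * q / w = a * q / w * q := fun w => by ring
  simp only [WRegTerm, WLower, sixCert, vwpFactor, qFins_cons, qFins_nil, qFin_zero, qFin_succ,
    List.map_cons, List.map_nil, qInfs_cons, qInfs_nil, pow_zero, mul_one, zero_add, pow_one,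
    hshift, qInf_eq_mul hq (a * q / _)]
  linear_combination qInf q q * (qInf q (a * q / c * q) * qInf q (a * q / d * q) *
    qInf q (a * q / e * q)) * hcertificate

theorem sixSum_contiguous (hq0 : q ≠ 0) (hq : ‖q‖ < 1) (hz0 : z ≠ 0) (hc : c ≠ 0) (hd : d ≠ 0)
    (he : e ≠ 0) (hz : z * q = c * d * e) {a : ℂ} (ha : ‖a / z‖ < 1) :
    (1 - a / z) * sixSum q c d e z a =
      (1 - a * q) * ((1 - c * (a / z)) * (1 - d * (a / z)) * (1 - e * (a / z))) *
        sixSum q c d e z (a * q) := by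
  have hsum := (summable_WRegTerm hq a [c, d, e] ha).mul_left (1 - a / z)
  have hsum' := (summable_WRegTerm hq (a * q) [c, d, e] (norm_mul_div_lt_one hq ha)).mul_left
    ((1 - a * q) * ((1 - c * (a / z)) * (1 - d * (a / z)) * (1 - e * (a / z))))
  have htsum := tsum_eq_of_telescoping (hsum.sub hsum')
    (sixSum_step_zero hq0 hq hz0 hc hd he hz a) (sixSum_step hq0 hq hz0 hc hd he hz a)
    (tendsto_sixCert hq ha)
  rwa [hsum.tsum_sub hsum', tsum_mul_left, tsum_mul_left, sub_eq_zero] at htsum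

theorem sixSum_zero (q c d e z : ℂ) : sixSum q c d e z 0 = qInf q q := by
  rw [sixSum, WReg, tsum_eq_single 0 fun n hn => by simp [WRegTerm, hn]]
  simp [WRegTerm, WLower, vwpFactor, qFin_zero, qInf_zero]

theorem continuousAt_sixSum (hq : ‖q‖ < 1) (hc : c ≠ 0) (hd : d ≠ 0) (he : e ≠ 0) :
    ContinuousAt (sixSum q c d e z) 0 := by
  have hU : IsOpen {a : ℂ | ‖a / z‖ < 1} := isOpen_lt (by fun_prop) continuous_const
  have hdiff := differentiableOn_WReg (fs := [fun _ => c, fun _ => d, fun _ => e]) hq hU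
    differentiableOn_id (by simp) (by simp [hc, hd, he]) (differentiableOn_id.div_const z)
    fun _ ha => ha
  exact (hdiff.differentiableAt (hU.mem_nhds (by simp))).continuousAt

theorem sixSum_mul_qInf (hq0 : q ≠ 0) (hq : ‖q‖ < 1) (hz0 : z ≠ 0) (hc : c ≠ 0) (hd : d ≠ 0)
    (he : e ≠ 0) (hz : z * q = c * d * e) {a : ℂ} (ha : ‖a / z‖ < 1) :
    sixSum q c d e z a * qInf q (a / z) =
      qInfs q [q * a, c / z * a, d / z * a, e / z * a] * qInf q q := by
  have hcont : ContinuousAt (fun a => sixSum q c d e z a * qInf q (a / z)) 0 :=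
    (continuousAt_sixSum hq hc hd he).mul
      ((continuous_qInf hq).comp (continuous_id.div_const z)).continuousAt
  have hfactor : ∀ b ∈ {b : ℂ | ‖b / z‖ < 1}, sixSum q c d e z b * qInf q (b / z) =
      ([q, c / z, d / z, e / z].map (1 - · * b)).prod *
        (sixSum q c d e z (b * q) * qInf q (b * q / z)) := by
    intro b hb
    rw [qInf_eq_mul hq (b / z), div_mul_eq_mul_div]
    simp only [List.map_cons, List.map_nil, List.prod_cons, List.prod_nil]
    linear_combination qInf q (b * q / z) * sixSum_contiguous hq0 hq hz0 hc hd he hz hb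
  have hmem : ∀ b ∈ {b : ℂ | ‖b / z‖ < 1}, b * q ∈ {b : ℂ | ‖b / z‖ < 1} :=
    fun _ hb => norm_mul_div_lt_one hq hb
  simpa [sixSum_zero, qInf_zero] using eq_qInfs_mul_of_eq_prod_mul hq hmem hfactor hcont ha

end SixPhiFive

section LeftSeries

variable {q c d e z : ℂ}

/-- The series `₈W₇[a; c, d, e, a/z, z; q, aq/z]`, regularised as in `WReg`. -/
noncomputable def leftSum (q c d e z a : ℂ) : ℂ := WReg a [c, d, e, a / z, z] q (a * q / z)

theorem WLower_left {a : ℂ} (ha : a ≠ 0) : WLower a [c, d, e, a / z, z] q =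
    [q, a * q / c, a * q / d, a * q / e, z * q, a * q / z] := by
  have h : a * q / (a / z) = z * q := by field_simp
  simp only [WLower, List.map_cons, List.map_nil, h]

/-- The common factor of the terms of index `n + 1` in the contiguous relation between
`leftSum q c d e z a`, `leftSum q c d e z (a * q)` and `sixSum q c d e z (a * q)`. -/
noncomputable def leftFactor (q c d e z a : ℂ) (n : ℕ) : ℂ :=
  qFin q (a * q) n * qFins q [c, d, e] (n + 1) * qFin q (a * q / z) n * qFin q z (n + 1) *
    qInfs q ([a * q / c, a * q / d, a * q / e, a * q / z].map (· * q ^ (n + 2))) *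
    qInf q (z * q * q ^ (n + 1)) * qInf q (q * q ^ (n + 1)) * (a * q / z) ^ (n + 1)

/-- The telescoping certificate for the contiguous relation of `leftSum`: the sequence whose
differences are the terms of the relation. -/
noncomputable def leftCert (q c d e z a : ℂ) (n : ℕ) : ℂ :=
  a / z * (qFin q (a * q) n * qFins q [c, d, e] (n + 1) * qFin q (a * q / z) n * qInf q z *
    qInfs q ([a * q / c, a * q / d, a * q / e, a * q / z].map (· * q ^ (n + 1))) *
    qInf q (q * q ^ n)) * (a * q / z) ^ (n + 1)

theorem tendsto_leftCert (hq : ‖q‖ < 1) {a : ℂ} (ha : ‖a * q / z‖ < 1) :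
    Tendsto (leftCert q c d e z a) atTop (𝓝 0) := by
  have hpow : Tendsto (fun n : ℕ => (a * q / z) ^ (n + 1)) atTop (𝓝 0) :=
    (tendsto_add_atTop_iff_nat 1).2 (tendsto_pow_atTop_nhds_zero_of_norm_lt_one ha)
  have hfins := (tendsto_add_atTop_iff_nat 1).2 (tendsto_qFins hq [c, d, e])
  have hinfs := (tendsto_add_atTop_iff_nat 1).2
    (tendsto_qInfs_map_mul_qpow hq [a * q / c, a * q / d, a * q / e, a * q / z])
  have hcert := (((((((tendsto_qFin hq (a * q)).mul hfins).mul
    (tendsto_qFin hq (a * q / z))).mul_const (qInf q z)).mul hinfs).mul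
    (tendsto_qInf_mul_qpow hq q)).const_mul (a / z)).mul hpow
  rw [mul_zero] at hcert
  exact hcert

theorem leftTerm_succ (hq : ‖q‖ < 1) {a : ℂ} (ha : a ≠ 0) (n : ℕ) :
    WRegTerm a [c, d, e, a / z, z] q (a * q / z) (n + 1) =
      leftFactor q c d e z a n * ((1 - a * (q ^ (n + 1)) ^ 2) *
        ((1 - a * q / c * q ^ (n + 1)) * (1 - a * q / d * q ^ (n + 1)) *
          (1 - a * q / e * q ^ (n + 1))) * (1 - a * q / z * q ^ (n + 1)) * (1 - a / z)) := by
  have hfin : qFin q (a / z) (n + 1) = (1 - a / z) * qFin q (a * q / z) n := by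
    rw [qFin_succ', div_mul_eq_mul_div]
  have hinf : ∀ w, qInf q (a * q / w * q ^ (n + 1)) =
      (1 - a * q / w * q ^ (n + 1)) * qInf q (a * q / w * q ^ (n + 2)) :=
    fun w => qInf_mul_qpow hq _ _
  rw [WRegTerm, WLower_left ha, vwpFactor_succ, leftFactor]
  simp only [List.map_cons, List.map_nil, qFins_cons, qFins_nil, qInfs_cons, qInfs_nil, hfin,
    hinf]
  ring

theorem leftTerm_shift_succ (hq0 : q ≠ 0) {a : ℂ} (ha : a ≠ 0) (n : ℕ) :
    (1 - a * q) * WRegTerm (a * q) [c, d, e, a * q / z, z] q (a * q * q / z) (n + 1) =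
      leftFactor q c d e z a n * ((1 - a * q * (q ^ (n + 1)) ^ 2) * (1 - a * q ^ (n + 1)) *
        (1 - a / z * q ^ (n + 1)) * q ^ (n + 1)) := by
  have hv := one_sub_mul_vwpFactor_succ q a n
  have hpow : (a * q * q / z) ^ (n + 1) = (a * q / z) ^ (n + 1) * q ^ (n + 1) := by
    rw [← mul_pow]; ring
  have hshift : ∀ w, a * q * q / w * q ^ (n + 1) = a * q / w * q ^ (n + 2) := fun w => by ring
  rw [WRegTerm, WLower_left (mul_ne_zero ha hq0), leftFactor]
  simp only [List.map_cons, List.map_nil, qFins_cons, qFins_nil, qInfs_cons, qInfs_nil, hshift,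
    hpow, qFin_succ q (a * q / z) n]
  linear_combination qFin q c (n + 1) * qFin q d (n + 1) * qFin q e (n + 1) *
    qFin q (a * q / z) n * (1 - a * q / z * q ^ n) * qFin q z (n + 1) * qInf q (q * q ^ (n + 1)) *
    (qInf q (a * q / c * q ^ (n + 2)) * qInf q (a * q / d * q ^ (n + 2)) *
      qInf q (a * q / e * q ^ (n + 2)) * qInf q (z * q * q ^ (n + 1)) *
      qInf q (a * q / z * q ^ (n + 2))) * ((a * q / z) ^ (n + 1) * q ^ (n + 1)) * hv

theorem leftTerm_six_succ (hq : ‖q‖ < 1) (a : ℂ) (n : ℕ) :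
    qInf q z * qInf q (a * q / z) * ((1 - a * q) *
        WRegTerm (a * q) [c, d, e] q (a * q / z) (n + 1)) =
      leftFactor q c d e z a n * ((1 - z * q ^ (n + 1)) * (1 - a * q ^ (n + 1)) *
        (1 - a * q * (q ^ (n + 1)) ^ 2) * (1 - a / z * q ^ (n + 1)) *
          (1 - a * q / z * q ^ (n + 1))) := by
  have hv := one_sub_mul_vwpFactor_succ q a n
  have hshift : ∀ w, a * q * q / w * q ^ (n + 1) = a * q / w * q ^ (n + 2) := fun w => by ring
  have hinf : qInf q (a * q / z) = qFin q (a * q / z) n * ((1 - a / z * q ^ (n + 1)) *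
      ((1 - a * q / z * q ^ (n + 1)) * qInf q (a * q / z * q ^ (n + 2)))) := by
    rw [← qFin_mul_qInf hq (a * q / z) n, qInf_mul_qpow hq, qInf_mul_qpow hq _ (n + 1)]
    ring
  simp only [WRegTerm, WLower, leftFactor, List.map_cons, List.map_nil, qInfs_cons, qInfs_nil,
    hshift, hinf, qInf_eq_qFin_succ_mul hq z n]
  linear_combination qFin q z (n + 1) * ((1 - z * q ^ (n + 1)) * qInf q (z * q * q ^ (n + 1))) *
    (qFin q (a * q / z) n * ((1 - a / z * q ^ (n + 1)) *
      ((1 - a * q / z * q ^ (n + 1)) * qInf q (a * q / z * q ^ (n + 2))))) *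
    qFins q [c, d, e] (n + 1) * qInf q (q * q ^ (n + 1)) *
    (qInf q (a * q / c * q ^ (n + 2)) * qInf q (a * q / d * q ^ (n + 2)) *
      qInf q (a * q / e * q ^ (n + 2))) * (a * q / z) ^ (n + 1) * hv

theorem leftCert_succ (hq : ‖q‖ < 1) (a : ℂ) (n : ℕ) :
    leftCert q c d e z a (n + 1) =
      leftFactor q c d e z a n * ((1 - a * q ^ (n + 1)) *
        ((1 - c * q ^ (n + 1)) * (1 - d * q ^ (n + 1)) * (1 - e * q ^ (n + 1))) *
        (1 - a / z * q ^ (n + 1)) * (1 - z * q ^ (n + 1)) * (a / z * (a * q / z))) := by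
  rw [leftCert, leftFactor, qFins_succ q _ (n + 1), qFin_succ, qFin_succ q (a * q / z),
    qInf_eq_qFin_succ_mul hq z n]
  simp only [List.map_cons, List.map_nil, List.prod_cons, List.prod_nil]
  ring

theorem leftCert_eq (hq : ‖q‖ < 1) (a : ℂ) (n : ℕ) :
    leftCert q c d e z a n =
      leftFactor q c d e z a n * ((1 - z * q ^ (n + 1)) *
        ((1 - a * q / c * q ^ (n + 1)) * (1 - a * q / d * q ^ (n + 1)) *
          (1 - a * q / e * q ^ (n + 1))) * (1 - a * q / z * q ^ (n + 1)) * (1 - q ^ (n + 1)) *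
        (a / z)) := by
  rw [leftCert, leftFactor, qInfs_map_mul_qpow hq, qInf_mul_qpow hq, qInf_eq_qFin_succ_mul hq z n]
  simp only [List.map_cons, List.map_nil, List.prod_cons, List.prod_nil]
  ring

theorem leftSum_certificate_succ (hq0 : q ≠ 0) (hz0 : z ≠ 0) (hc : c ≠ 0) (hd : d ≠ 0)
    (he : e ≠ 0) (hz : z * q = c * d * e) (a x : ℂ) :
    (1 - a * x ^ 2) * ((1 - a * q * x / c) * (1 - a * q * x / d) * (1 - a * q * x / e)) *
        (1 - a * q * x / z) * (1 - a / z) -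
      z * ((1 - a * q / z / c) * (1 - a * q / z / d) * (1 - a * q / z / e)) *
        ((1 - a * q * x ^ 2) * (1 - a * x) * (1 - a / z * x) * x) -
      (1 - a ^ 2 * q / z ^ 2) * ((1 - z * x) * (1 - a * x) * (1 - a * q * x ^ 2) *
        (1 - a / z * x) * (1 - a * q * x / z)) =
    (1 - a * x) * ((1 - c * x) * (1 - d * x) * (1 - e * x)) * (1 - a / z * x) * (1 - z * x) *
        (a / z * (a * q / z)) -
      (1 - z * x) * ((1 - a * q * x / c) * (1 - a * q * x / d) * (1 - a * q * x / e)) *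
        (1 - a * q * x / z) * (1 - x) * (a / z) := by
  simp only [prod_one_sub_mul hz, prod_one_sub_div hc hd he hz]
  field_simp
  ring

theorem leftSum_certificate_zero (hq0 : q ≠ 0) (hz0 : z ≠ 0) (hc : c ≠ 0) (hd : d ≠ 0)
    (he : e ≠ 0) (hz : z * q = c * d * e) (a : ℂ) :
    (1 - a * q / c) * (1 - a * q / d) * (1 - a * q / e) * (1 - a * q / z) -
      z * ((1 - a * q / z / c) * (1 - a * q / z / d) * (1 - a * q / z / e)) * (1 - a * q) -
      (1 - a ^ 2 * q / z ^ 2) * ((1 - z) * (1 - a * q / z) * (1 - a * q)) =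
    (1 - c) * (1 - d) * (1 - e) * (1 - z) * (a / z * (a * q / z)) := by
  have hone := prod_one_sub_mul hz 1
  simp only [mul_one] at hone
  simp only [prod_one_sub_div hc hd he hz, hone]
  field_simp
  ring

theorem leftSum_step (hq0 : q ≠ 0) (hq : ‖q‖ < 1) (hz0 : z ≠ 0) (hc : c ≠ 0) (hd : d ≠ 0)
    (he : e ≠ 0) (hz : z * q = c * d * e) {a : ℂ} (ha : a ≠ 0) (n : ℕ) :
    WRegTerm a [c, d, e, a / z, z] q (a * q / z) (n + 1) -
      z * ((1 - a * q / z / c) * (1 - a * q / z / d) * (1 - a * q / z / e)) * (1 - a * q) *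
        WRegTerm (a * q) [c, d, e, a * q / z, z] q (a * q * q / z) (n + 1) -
      qInf q z * (1 - a * q) * (1 - a ^ 2 * q / z ^ 2) * qInf q (a * q / z) *
        WRegTerm (a * q) [c, d, e] q (a * q / z) (n + 1) =
      leftCert q c d e z a (n + 1) - leftCert q c d e z a n := by
  have hcertificate := leftSum_certificate_succ hq0 hz0 hc hd he hz a (q ^ (n + 1))
  have hshift := leftTerm_shift_succ (c := c) (d := d) (e := e) (z := z) hq0 ha n
  have hsix := leftTerm_six_succ (c := c) (d := d) (e := e) (z := z) hq a n
  rw [leftTerm_succ hq ha, leftCert_succ hq, leftCert_eq hq]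
  linear_combination leftFactor q c d e z a n * hcertificate -
    z * ((1 - a * q / z / c) * (1 - a * q / z / d) * (1 - a * q / z / e)) * hshift -
    (1 - a ^ 2 * q / z ^ 2) * hsix

theorem leftSum_step_zero (hq0 : q ≠ 0) (hq : ‖q‖ < 1) (hz0 : z ≠ 0) (hc : c ≠ 0) (hd : d ≠ 0)
    (he : e ≠ 0) (hz : z * q = c * d * e) {a : ℂ} (ha : a ≠ 0) :
    WRegTerm a [c, d, e, a / z, z] q (a * q / z) 0 -
      z * ((1 - a * q / z / c) * (1 - a * q / z / d) * (1 - a * q / z / e)) * (1 - a * q) *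
        WRegTerm (a * q) [c, d, e, a * q / z, z] q (a * q * q / z) 0 -
      qInf q z * (1 - a * q) * (1 - a ^ 2 * q / z ^ 2) * qInf q (a * q / z) *
        WRegTerm (a * q) [c, d, e] q (a * q / z) 0 =
      leftCert q c d e z a 0 := by
  have hcertificate := leftSum_certificate_zero hq0 hz0 hc hd he hz a
  have hshift : ∀ w, a * q * q / w = a * q / w * q := fun w => by ring
  rw [WRegTerm, WRegTerm, WRegTerm, WLower_left ha, WLower_left (mul_ne_zero ha hq0)]
  simp only [WLower, leftCert, vwpFactor, qFins_cons, qFins_nil, qFin_zero, qFin_succ,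
    List.map_cons, List.map_nil, qInfs_cons, qInfs_nil, pow_zero, mul_one, one_mul, zero_add,
    pow_one, hshift, qInf_eq_mul hq (a * q / _), qInf_eq_mul hq z]
  linear_combination qInf q q * qInf q (z * q) * (qInf q (a * q / c * q) *
    qInf q (a * q / d * q) * qInf q (a * q / e * q) * qInf q (a * q / z * q)) * hcertificate

theorem leftSum_contiguous_sixSum (hq0 : q ≠ 0) (hq : ‖q‖ < 1) (hz0 : z ≠ 0) (hc : c ≠ 0)
    (hd : d ≠ 0) (he : e ≠ 0) (hz : z * q = c * d * e) {a : ℂ} (ha0 : a ≠ 0)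
    (ha : ‖a * q / z‖ < 1) :
    leftSum q c d e z a =
      z * ((1 - a * q / z / c) * (1 - a * q / z / d) * (1 - a * q / z / e)) * (1 - a * q) *
          leftSum q c d e z (a * q) +
        qInf q z * (1 - a * q) * (1 - a ^ 2 * q / z ^ 2) * qInf q (a * q / z) *
          sixSum q c d e z (a * q) := by
  have hsum := summable_WRegTerm hq a [c, d, e, a / z, z] ha
  have hsum' := (summable_WRegTerm hq (a * q) [c, d, e, a * q / z, z]
    (norm_mul_div_lt_one hq ha)).mul_left
    (z * ((1 - a * q / z / c) * (1 - a * q / z / d) * (1 - a * q / z / e)) * (1 - a * q))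
  have hsum6 := (summable_WRegTerm hq (a * q) [c, d, e] ha).mul_left
    (qInf q z * (1 - a * q) * (1 - a ^ 2 * q / z ^ 2) * qInf q (a * q / z))
  have htsum := tsum_eq_of_telescoping ((hsum.sub hsum').sub hsum6)
    (leftSum_step_zero hq0 hq hz0 hc hd he hz ha0) (leftSum_step hq0 hq hz0 hc hd he hz ha0)
    (tendsto_leftCert hq ha)
  rwa [(hsum.sub hsum').tsum_sub hsum6, hsum.tsum_sub hsum', tsum_mul_left, tsum_mul_left, sub_sub,
    sub_eq_zero] at htsum

theorem leftSum_contiguous (hq0 : q ≠ 0) (hq : ‖q‖ < 1) (hz0 : z ≠ 0) (hc : c ≠ 0)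
    (hd : d ≠ 0) (he : e ≠ 0) (hz : z * q = c * d * e) {a : ℂ} (ha0 : a ≠ 0)
    (ha : ‖a * q / z‖ < 1) :
    leftSum q c d e z a =
      z * ((1 - a * q / z / c) * (1 - a * q / z / d) * (1 - a * q / z / e)) * (1 - a * q) *
          leftSum q c d e z (a * q) +
        (1 - a ^ 2 * q / z ^ 2) * qInfs q [q, z, a * q, c * (a * q / z), d * (a * q / z),
          e * (a * q / z)] := by
  have hsix := sixSum_mul_qInf hq0 hq hz0 hc hd he hz ha
  have hswap : ∀ w, w / z * (a * q) = w * (a * q / z) := fun w => by ring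
  rw [leftSum_contiguous_sixSum hq0 hq hz0 hc hd he hz ha0 ha]
  simp only [qInfs_cons, qInfs_nil, hswap, qInf_eq_mul hq (a * q), mul_comm q (a * q)] at hsix ⊢
  linear_combination qInf q z * (1 - a * q) * (1 - a ^ 2 * q / z ^ 2) * hsix

end LeftSeries

section RightSeries

variable {q c d e z : ℂ}

/-- The series `₈W₇[1/z; a/z, c/z, d/z, e/z, z/a; q, q]`, regularised as in `WReg`. -/
noncomputable def rightSum (q c d e z a : ℂ) : ℂ :=
  WReg (1 / z) [a / z, c / z, d / z, e / z, z / a] q q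

theorem WLower_right (hz0 : z ≠ 0) (a : ℂ) :
    WLower (1 / z) [a / z, c / z, d / z, e / z, z / a] q =
      [q, q / a, q / c, q / d, q / e, a * q / z ^ 2] := by
  have h : ∀ w, 1 / z * q / (w / z) = q / w := fun w => by field_simp
  have h' : 1 / z * q / (z / a) = a * q / z ^ 2 := by field_simp
  simp only [WLower, List.map_cons, List.map_nil, h, h']

/-- The common factor of the terms of index `n + 1` of the series `rightSum q c d e z a` and
`rightSum q c d e z (a * q)` and of the certificate `rightCert`. -/
noncomputable def rightFactor (q c d e z a : ℂ) (n : ℕ) : ℂ :=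
  qFin q (a * q / z) n * qFin q (z / a) n * qFin q (q / z) n *
    qFins q [c / z, d / z, e / z] (n + 1) *
    qInfs q ([q / a, q / c, q / d, q / e, q].map (· * q ^ (n + 1))) *
    qInf q (a * q / z ^ 2 * q ^ (n + 2))

/-- The telescoping certificate for the contiguous relation of `rightSum`: the sequence whose
differences are the terms of the relation. -/
noncomputable def rightCert (q c d e z a : ℂ) (n : ℕ) : ℂ :=
  a * (1 - a ^ 2 * q / z ^ 2) * (qFin q (a * q / z) n * qFin q (z / a) n * qFin q (q / z) n *
    qFins q [c / z, d / z, e / z] (n + 1) *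
    qInfs q ([q / a, q / c, q / d, q / e, q].map (· * q ^ n)) *
    qInf q (a * q / z ^ 2 * q ^ (n + 1)))

theorem tendsto_rightCert (hq : ‖q‖ < 1) (a : ℂ) :
    Tendsto (rightCert q c d e z a) atTop (𝓝 (a * (1 - a ^ 2 * q / z ^ 2) *
      qInfs q [a * q / z, z / a, q / z, c / z, d / z, e / z])) := by
  have hfins := (tendsto_add_atTop_iff_nat 1).2 (tendsto_qFins hq [c / z, d / z, e / z])
  have hinf := (tendsto_add_atTop_iff_nat 1).2 (tendsto_qInf_mul_qpow hq (a * q / z ^ 2))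
  have hcert := ((((((tendsto_qFin hq (a * q / z)).mul (tendsto_qFin hq (z / a))).mul
    (tendsto_qFin hq (q / z))).mul hfins).mul
    (tendsto_qInfs_map_mul_qpow hq [q / a, q / c, q / d, q / e, q])).mul hinf).const_mul
    (a * (1 - a ^ 2 * q / z ^ 2))
  unfold rightCert
  simpa only [qInfs_cons, qInfs_nil, mul_one, mul_assoc] using hcert

theorem rightTerm_succ (hq0 : q ≠ 0) (hq : ‖q‖ < 1) (hz0 : z ≠ 0) (a : ℂ) (n : ℕ) :
    WRegTerm (1 / z) [a / z, c / z, d / z, e / z, z / a] q q (n + 1) =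
      rightFactor q c d e z a n * ((1 - 1 / z * (q ^ (n + 1)) ^ 2) * (1 - a / z) *
        (1 - z / (a * q) * q ^ (n + 1)) * (1 - a * q / z ^ 2 * q ^ (n + 1)) * q ^ (n + 1)) := by
  have hfin : qFin q (a / z) (n + 1) = (1 - a / z) * qFin q (a * q / z) n := by
    rw [qFin_succ', div_mul_eq_mul_div]
  have hpow : z / (a * q) * q ^ (n + 1) = z / a * q ^ n := by rw [pow_succ']; field_simp
  rw [WRegTerm, WLower_right hz0, vwpFactor_succ, rightFactor, hpow]
  simp only [List.map_cons, List.map_nil, qFins_cons, qFins_nil, qInfs_cons, qInfs_nil, hfin,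
    qFin_succ q (z / a) n, qInf_mul_qpow hq (a * q / z ^ 2) (n + 1), one_div_mul_eq_div]
  ring

theorem rightTerm_shift_succ (hq0 : q ≠ 0) (hq : ‖q‖ < 1) (hz0 : z ≠ 0) (a : ℂ) (n : ℕ) :
    WRegTerm (1 / z) [a * q / z, c / z, d / z, e / z, z / (a * q)] q q (n + 1) =
      rightFactor q c d e z a n * ((1 - 1 / z * (q ^ (n + 1)) ^ 2) * (1 - a / z * q ^ (n + 1)) *
        (1 - z / (a * q)) * (1 - q ^ (n + 1) / a) * q ^ (n + 1)) := by
  have hfin : qFin q (z / (a * q)) (n + 1) = (1 - z / (a * q)) * qFin q (z / a) n := by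
    rw [qFin_succ', div_mul_eq_mul_div, mul_div_mul_right _ _ hq0]
  have hinf : qInf q (q / (a * q) * q ^ (n + 1)) =
      (1 - q ^ (n + 1) / a) * qInf q (q / a * q ^ (n + 1)) := by
    rw [show q / (a * q) * q ^ (n + 1) = q / a * q ^ n by rw [pow_succ']; field_simp,
      qInf_mul_qpow hq]
    ring
  have hlower : a * q * q / z ^ 2 * q ^ (n + 1) = a * q / z ^ 2 * q ^ (n + 2) := by ring
  rw [WRegTerm, WLower_right hz0, vwpFactor_succ, rightFactor]
  simp only [List.map_cons, List.map_nil, qFins_cons, qFins_nil, qInfs_cons, qInfs_nil, hfin,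
    hinf, hlower, qFin_succ q (a * q / z) n, one_div_mul_eq_div]
  ring

theorem rightCert_succ (hq0 : q ≠ 0) (a : ℂ) (n : ℕ) :
    rightCert q c d e z a (n + 1) =
      rightFactor q c d e z a n * (a * (1 - a ^ 2 * q / z ^ 2) * ((1 - a / z * q ^ (n + 1)) *
        (1 - z / (a * q) * q ^ (n + 1)) * (1 - q ^ (n + 1) / z) *
        ((1 - c * (q ^ (n + 1) / z)) * (1 - d * (q ^ (n + 1) / z)) *
          (1 - e * (q ^ (n + 1) / z))))) := by
  have hpow : z / (a * q) * q ^ (n + 1) = z / a * q ^ n := by rw [pow_succ']; field_simp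
  rw [rightCert, rightFactor, hpow, qFins_succ q _ (n + 1), qFin_succ, qFin_succ, qFin_succ]
  simp only [List.map_cons, List.map_nil, List.prod_cons, List.prod_nil]
  ring

theorem rightCert_eq (hq : ‖q‖ < 1) (a : ℂ) (n : ℕ) :
    rightCert q c d e z a n =
      rightFactor q c d e z a n * (a * (1 - a ^ 2 * q / z ^ 2) * ((1 - q ^ (n + 1) / a) *
        ((1 - q ^ (n + 1) / c) * (1 - q ^ (n + 1) / d) * (1 - q ^ (n + 1) / e)) *
        (1 - q ^ (n + 1)) * (1 - a * q / z ^ 2 * q ^ (n + 1)))) := by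
  rw [rightCert, rightFactor, qInfs_map_mul_qpow hq, qInf_mul_qpow hq _ (n + 1)]
  simp only [List.map_cons, List.map_nil, List.prod_cons, List.prod_nil]
  ring

theorem rightSum_certificate_succ (hq0 : q ≠ 0) (hz0 : z ≠ 0) (hc : c ≠ 0) (hd : d ≠ 0)
    (he : e ≠ 0) (hz : z * q = c * d * e) {a : ℂ} (ha : a ≠ 0) (x : ℂ) :
    (1 - c * (a / z)) * (1 - d * (a / z)) * (1 - e * (a / z)) *
        ((1 - 1 / z * x ^ 2) * (1 - a / z) * (1 - z / (a * q) * x) *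
          (1 - a * q / z ^ 2 * x) * x) +
      a * ((1 - a * q / z / c) * (1 - a * q / z / d) * (1 - a * q / z / e)) *
        ((1 - 1 / z * x ^ 2) * (1 - a / z * x) * (1 - z / (a * q)) * (1 - x / a) * x) =
    a * (1 - a ^ 2 * q / z ^ 2) * ((1 - a / z * x) * (1 - z / (a * q) * x) * (1 - x / z) *
        ((1 - c * (x / z)) * (1 - d * (x / z)) * (1 - e * (x / z)))) -
      a * (1 - a ^ 2 * q / z ^ 2) * ((1 - x / a) * ((1 - x / c) * (1 - x / d) * (1 - x / e)) *
        (1 - x) * (1 - a * q / z ^ 2 * x)) := by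
  simp only [prod_one_sub_mul hz, prod_one_sub_div hc hd he hz]
  field_simp
  ring

theorem rightSum_certificate_zero (hq0 : q ≠ 0) (hz0 : z ≠ 0) (hc : c ≠ 0) (hd : d ≠ 0)
    (he : e ≠ 0) (hz : z * q = c * d * e) {a : ℂ} (ha : a ≠ 0) :
    (1 - c * (a / z)) * (1 - d * (a / z)) * (1 - e * (a / z)) * (1 - a * q / z ^ 2) +
      a * ((1 - a * q / z / c) * (1 - a * q / z / d) * (1 - a * q / z / e)) * (1 - 1 / a) =
    a * (1 - a ^ 2 * q / z ^ 2) *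
      ((1 - c * (1 / z)) * (1 - d * (1 / z)) * (1 - e * (1 / z))) := by
  simp only [prod_one_sub_mul hz, prod_one_sub_div hc hd he hz]
  field_simp
  ring

theorem rightSum_step (hq0 : q ≠ 0) (hq : ‖q‖ < 1) (hz0 : z ≠ 0) (hc : c ≠ 0) (hd : d ≠ 0)
    (he : e ≠ 0) (hz : z * q = c * d * e) {a : ℂ} (ha : a ≠ 0) (n : ℕ) :
    (1 - c * (a / z)) * (1 - d * (a / z)) * (1 - e * (a / z)) *
        WRegTerm (1 / z) [a / z, c / z, d / z, e / z, z / a] q q (n + 1) +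
      a * ((1 - a * q / z / c) * (1 - a * q / z / d) * (1 - a * q / z / e)) *
        WRegTerm (1 / z) [a * q / z, c / z, d / z, e / z, z / (a * q)] q q (n + 1) =
      rightCert q c d e z a (n + 1) - rightCert q c d e z a n := by
  rw [rightTerm_succ hq0 hq hz0, rightTerm_shift_succ hq0 hq hz0, rightCert_succ hq0,
    rightCert_eq hq]
  linear_combination rightFactor q c d e z a n *
    rightSum_certificate_succ hq0 hz0 hc hd he hz ha (q ^ (n + 1))

theorem rightSum_step_zero (hq0 : q ≠ 0) (hq : ‖q‖ < 1) (hz0 : z ≠ 0) (hc : c ≠ 0) (hd : d ≠ 0)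
    (he : e ≠ 0) (hz : z * q = c * d * e) {a : ℂ} (ha : a ≠ 0) :
    (1 - c * (a / z)) * (1 - d * (a / z)) * (1 - e * (a / z)) *
        WRegTerm (1 / z) [a / z, c / z, d / z, e / z, z / a] q q 0 +
      a * ((1 - a * q / z / c) * (1 - a * q / z / d) * (1 - a * q / z / e)) *
        WRegTerm (1 / z) [a * q / z, c / z, d / z, e / z, z / (a * q)] q q 0 =
      rightCert q c d e z a 0 := by
  have hcertificate := rightSum_certificate_zero hq0 hz0 hc hd he hz ha
  have hinf : qInf q (q / (a * q)) = (1 - 1 / a) * qInf q (q / a) := by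
    rw [show q / (a * q) = 1 / a by field_simp, qInf_eq_mul hq (1 / a), one_div_mul_eq_div]
  have hlower : a * q * q / z ^ 2 = a * q / z ^ 2 * q := by ring
  rw [WRegTerm, WRegTerm, WLower_right hz0, WLower_right hz0]
  simp only [rightCert, vwpFactor, qFins_cons, qFins_nil, qFin_zero, qFin_succ, List.map_cons,
    List.map_nil, qInfs_cons, qInfs_nil, pow_zero, mul_one, one_mul, zero_add, pow_one, hinf,
    hlower, qInf_eq_mul hq (a * q / z ^ 2)]
  linear_combination qInf q q * qInf q (q / a) * qInf q (q / c) * qInf q (q / d) *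
    qInf q (q / e) * qInf q (a * q / z ^ 2 * q) * hcertificate

theorem rightSum_contiguous (hq0 : q ≠ 0) (hq : ‖q‖ < 1) (hz0 : z ≠ 0) (hc : c ≠ 0)
    (hd : d ≠ 0) (he : e ≠ 0) (hz : z * q = c * d * e) {a : ℂ} (ha : a ≠ 0) :
    (1 - c * (a / z)) * (1 - d * (a / z)) * (1 - e * (a / z)) * rightSum q c d e z a +
      a * ((1 - a * q / z / c) * (1 - a * q / z / d) * (1 - a * q / z / e)) *
          rightSum q c d e z (a * q) =
        a * (1 - a ^ 2 * q / z ^ 2) *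
          qInfs q [a * q / z, z / a, q / z, c / z, d / z, e / z] := by
  have hsum := (summable_WRegTerm hq (1 / z) [a / z, c / z, d / z, e / z, z / a] hq).mul_left
    ((1 - c * (a / z)) * (1 - d * (a / z)) * (1 - e * (a / z)))
  have hsum' := (summable_WRegTerm hq (1 / z) [a * q / z, c / z, d / z, e / z, z / (a * q)]
    hq).mul_left (a * ((1 - a * q / z / c) * (1 - a * q / z / d) * (1 - a * q / z / e)))
  have htsum := tsum_eq_of_telescoping (hsum.add hsum')
    (rightSum_step_zero hq0 hq hz0 hc hd he hz ha) (rightSum_step hq0 hq hz0 hc hd he hz ha)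
    (tendsto_rightCert hq a)
  rwa [hsum.tsum_add hsum', tsum_mul_left, tsum_mul_left] at htsum

end RightSeries

section QDifference

open Metric

variable {q : ℂ}

theorem theta_eq_neg_mul_theta (hq0 : q ≠ 0) (hq : ‖q‖ < 1) {x : ℂ} (hx : x ≠ 0) :
    theta q x = -x * theta q (x * q) := by
  rw [theta_eq_qInf_mul_qInf hq0 hq hx, theta_eq_qInf_mul_qInf hq0 hq (mul_ne_zero hx hq0),
    qInf_eq_mul hq x, show q / (x * q) = 1 / x by field_simp, qInf_eq_mul hq (1 / x),
    one_div_mul_eq_div]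
  field_simp
  ring

theorem qInfs_map_mul (hq : ‖q‖ < 1) (xs : List ℂ) (w : ℂ) :
    qInfs q (xs.map (· * w)) =
      (xs.map (1 - · * w)).prod * qInfs q (xs.map (· * (w * q))) := by
  simpa [Function.comp_def, mul_assoc] using qInfs_map_mul_qpow hq (xs.map (· * w)) 0

theorem differentiable_qInfs_map_mul (hq : ‖q‖ < 1) (xs : List ℂ) :
    Differentiable ℂ fun w => qInfs q (xs.map (· * w)) := by
  rw [← differentiableOn_univ]
  simpa [Function.comp_def] using
    differentiableOn_qInfs_map (fs := xs.map fun x w => x * w) (U := Set.univ) hq fun f hf => by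
      obtain ⟨x, -, rfl⟩ := List.mem_map.1 hf
      exact differentiableOn_id.const_mul x

theorem mul_qpow_mem_ball_diff (hq0 : q ≠ 0) (hq : ‖q‖ < 1) {R : ℝ} {w : ℂ}
    (hw : w ∈ ball (0 : ℂ) R \ {0}) (n : ℕ) : w * q ^ n ∈ ball (0 : ℂ) R \ {0} := by
  refine ⟨?_, mul_ne_zero hw.2 (pow_ne_zero n hq0)⟩
  have hwR := mem_ball_zero_iff.1 hw.1
  rw [mem_ball_zero_iff, norm_mul, norm_pow]
  exact (mul_le_of_le_one_right (norm_nonneg _) (pow_le_one₀ (norm_nonneg _) hq.le)).trans_lt hwR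

section Iteration

variable {D g : ℂ → ℂ} {R : ℝ} (hq0 : q ≠ 0) (hq : ‖q‖ < 1)
  (hD : ∀ w ∈ ball (0 : ℂ) R \ {0}, D w = g w * D (w * q))
include hq0 hq hD

theorem eq_zero_of_mul_qpow_eq_zero {w : ℂ} (hw : w ∈ ball (0 : ℂ) R \ {0}) {n : ℕ}
    (h : D (w * q ^ n) = 0) : D w = 0 := by
  induction n with
  | zero => simpa using h
  | succ n ih =>
    refine ih ?_
    rw [hD _ (mul_qpow_mem_ball_diff hq0 hq hw n), mul_assoc w, ← pow_succ, h, mul_zero]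

theorem mul_qpow_eq_zero {w : ℂ} (hw : w ∈ ball (0 : ℂ) R \ {0})
    (hg : ∀ n : ℕ, g (w * q ^ n) ≠ 0) (h : D w = 0) (n : ℕ) : D (w * q ^ n) = 0 := by
  induction n with
  | zero => simpa using h
  | succ n ih =>
    rw [hD _ (mul_qpow_mem_ball_diff hq0 hq hw n), mul_assoc w, ← pow_succ] at ih
    exact (mul_eq_zero.1 ih).resolve_left (hg n)

end Iteration

theorem qInfs_map_mul_qpow_ne_zero (hq : ‖q‖ < 1) {xs : List ℂ} {w : ℂ}
    (h : qInfs q (xs.map (· * w)) ≠ 0) (n : ℕ) : qInfs q (xs.map (· * (w * q ^ n))) ≠ 0 := by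
  have hsplit := qFins_mul_qInfs hq (xs.map (· * w)) n
  simp only [List.map_map, Function.comp_def, mul_assoc] at hsplit
  exact right_ne_zero_of_mul (hsplit ▸ h)

theorem theta_mul_qpow_ne_zero (hq0 : q ≠ 0) (hq : ‖q‖ < 1) {x : ℂ} (hx : x ≠ 0)
    (h : theta q x ≠ 0) (n : ℕ) : theta q (x * q ^ n) ≠ 0 := by
  refine mt (eq_zero_of_mul_qpow_eq_zero (g := fun w => -w) (R := ‖x‖ + 1) hq0 hq
    (fun w hw => theta_eq_neg_mul_theta hq0 hq hw.2) ⟨?_, hx⟩) h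
  simp

theorem eqOn_zero_of_eq_neg_mul_prod_mul (hq0 : q ≠ 0) (hq : ‖q‖ < 1) {xs : List ℂ} {D : ℂ → ℂ}
    {R : ℝ} (hD : DifferentiableOn ℂ D (ball 0 R \ {0}))
    (hDq : ∀ w ∈ ball (0 : ℂ) R \ {0}, D w = -w * (xs.map (1 - · * w)).prod * D (w * q)) {b : ℂ}
    (hb : b ∈ ball (0 : ℂ) R \ {0}) (hDb : D b = 0) (hxs : qInfs q (xs.map (· * b)) ≠ 0)
    (hθ : theta q b ≠ 0) : Set.EqOn D 0 (ball 0 R \ {0}) := by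
  set N : ℂ → ℂ := fun w => qInfs q (xs.map (· * w)) with hN
  have hNdiff : Differentiable ℂ N := differentiable_qInfs_map_mul hq xs
  have hN0 : N 0 ≠ 0 := by simp [hN, qInfs, qInf_zero, Function.comp_def]
  have hRpos : 0 < R := (norm_nonneg b).trans_lt (mem_ball_zero_iff.1 hb.1)
  obtain ⟨r, hr, hNr⟩ := Metric.eventually_nhds_iff_ball.1
    ((hNdiff.continuous.continuousAt.eventually_ne hN0).and (ball_mem_nhds 0 hRpos))
  have hsub : ball (0 : ℂ) r \ {0} ⊆ ball 0 R \ {0} := fun w hw => ⟨(hNr w hw.1).2, hw.2⟩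
  have hmem : ∀ w : ℂ, w ≠ 0 → ∃ n : ℕ, w * q ^ n ∈ ball (0 : ℂ) r \ {0} := fun w hw =>
    (((tendsto_qpow hq w).eventually (ball_mem_nhds 0 hr)).exists).imp
      fun n hn => ⟨hn, mul_ne_zero hw (pow_ne_zero n hq0)⟩
  have hquot : ∀ w ∈ ball (0 : ℂ) r \ {0}, D w / N w = -w * (D (w * q) / N (w * q)) := by
    intro w hw
    have hNw : N w = (xs.map (1 - · * w)).prod * N (w * q) := qInfs_map_mul hq xs w
    have hNw0 := (hNr w hw.1).1
    rw [hNw] at hNw0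
    rw [hDq w (hsub hw), hNw, mul_comm (-w), mul_assoc _ (-w),
      mul_div_mul_left _ _ (left_ne_zero_of_mul hNw0), mul_div_assoc]
  have hfactor : ∀ n : ℕ, -(b * q ^ n) * (xs.map (1 - · * (b * q ^ n))).prod ≠ 0 := fun n =>
    mul_ne_zero (neg_ne_zero.2 (mul_ne_zero hb.2 (pow_ne_zero n hq0)))
      (left_ne_zero_of_mul (qInfs_map_mul hq xs _ ▸ qInfs_map_mul_qpow_ne_zero hq hxs n))
  obtain ⟨k, hk⟩ := hmem b hb.2
  have hzero := eqOn_zero_of_theta_ne_zero hq0 hq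
    ((hD.mono hsub).div hNdiff.differentiableOn fun w hw => (hNr w hw.1).1) hquot hk
    (by simp [mul_qpow_eq_zero hq0 hq hDq hb hfactor hDb k])
    (theta_mul_qpow_ne_zero hq0 hq hb.2 hθ k)
  intro a ha
  obtain ⟨n, hn⟩ := hmem a ha.2
  exact eq_zero_of_mul_qpow_eq_zero hq0 hq hDq ha
    ((div_eq_zero_iff.1 (hzero hn)).resolve_right (hNr _ hn.1).1)

end QDifference

section ThreeTerm

open Metric

variable {q c d e z : ℂ}

theorem WReg_eq_qInfs_of_one_mem {a : ℂ} {l : List ℂ} (h : 1 ∈ l) (q z : ℂ) :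
    WReg a l q z = qInfs q (WLower a l q) := by
  rw [WReg, tsum_eq_single 0]
  · simp [WRegTerm, vwpFactor, qFins, qFin_zero]
  · intro n hn
    obtain ⟨m, rfl⟩ := Nat.exists_eq_succ_of_ne_zero hn
    have hzero : qFins q l (m + 1) = 0 :=
      List.prod_eq_zero (List.mem_map.2 ⟨1, h, qFin_one_succ q m⟩)
    rw [WRegTerm, hzero, mul_zero, zero_mul, zero_mul]

/-- The right-hand side of the three-term relation, multiplied by its denominators. -/
noncomputable def rightSide (q c d e z a : ℂ) : ℂ :=
  (1 - 1 / z) * qInfs q [z * q, q, a * q, c * (a / z), d * (a / z), e * (a / z)] *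
      rightSum q c d e z a +
    1 / z * qInfs q [q, q, q / z, c, d, e, a * q, q / a, a, a * q / z / c, a * q / z / d,
      a * q / z / e]

/-- The difference of the two sides of the three-term relation, multiplied by their
denominators. -/
noncomputable def threeTermDefect (q c d e z a : ℂ) : ℂ :=
  theta q (a / z) * qInfs q [q / z, c / z, d / z, e / z] * leftSum q c d e z a -
    rightSide q c d e z a

theorem rightSide_contiguous (hq0 : q ≠ 0) (hq : ‖q‖ < 1) (hz0 : z ≠ 0) (hc : c ≠ 0)
    (hd : d ≠ 0) (he : e ≠ 0) (hz : z * q = c * d * e) {a : ℂ} (ha : a ≠ 0) :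
    rightSide q c d e z a =
      -a * ((1 - a * q) * ((1 - a * q / z / c) * (1 - a * q / z / d) * (1 - a * q / z / e))) *
          rightSide q c d e z (a * q) +
        (1 - 1 / z) * qInfs q [z * q, q, a * q, c * (a * q / z), d * (a * q / z),
          e * (a * q / z)] * (a * (1 - a ^ 2 * q / z ^ 2) *
            qInfs q [a * q / z, z / a, q / z, c / z, d / z, e / z]) := by
  have hstep : ∀ w, qInf q (w * (a / z)) = (1 - w * (a / z)) * qInf q (w * (a * q / z)) := by
    intro w
    rw [qInf_eq_mul hq, show w * (a / z) * q = w * (a * q / z) by ring]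
  have hstep' : ∀ w, qInf q (a * q / z / w) = (1 - a * q / z / w) * qInf q (a * q * q / z / w) := by
    intro w
    rw [qInf_eq_mul hq, show a * q / z / w * q = a * q * q / z / w by ring]
  have hinv : qInf q (q / (a * q)) = (1 - 1 / a) * qInf q (q / a) := by
    rw [show q / (a * q) = 1 / a by field_simp, qInf_eq_mul hq (1 / a), one_div_mul_eq_div]
  rw [← rightSum_contiguous hq0 hq hz0 hc hd he hz ha, rightSide, rightSide]
  simp only [qInfs_cons, qInfs_nil, hstep, hstep', hinv, qInf_eq_mul hq a,
    qInf_eq_mul hq (a * q)]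
  field_simp
  ring

theorem threeTermDefect_contiguous (hq0 : q ≠ 0) (hq : ‖q‖ < 1) (hz0 : z ≠ 0) (hc : c ≠ 0)
    (hd : d ≠ 0) (he : e ≠ 0) (hz : z * q = c * d * e) {a : ℂ} (ha : a ≠ 0)
    (haz : ‖a * q / z‖ < 1) :
    threeTermDefect q c d e z a =
      -a * ([q, q / z / c, q / z / d, q / z / e].map (1 - · * a)).prod *
        threeTermDefect q c d e z (a * q) := by
  have htheta : theta q (a / z) = -(a / z) * theta q (a * q / z) := by
    rw [theta_eq_neg_mul_theta hq0 hq (div_ne_zero ha hz0), div_mul_eq_mul_div]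
  have hprod : ([q, q / z / c, q / z / d, q / z / e].map (1 - · * a)).prod =
      (1 - a * q) * ((1 - a * q / z / c) * (1 - a * q / z / d) * (1 - a * q / z / e)) := by
    simp only [List.map_cons, List.map_nil, List.prod_cons, List.prod_nil]
    ring
  have htheta' : theta q (a * q / z) = qInf q (a * q / z) * qInf q (z / a) := by
    rw [theta_eq_qInf_mul_qInf hq0 hq (div_ne_zero (mul_ne_zero ha hq0) hz0),
      show q / (a * q / z) = z / a by field_simp]
  have hleft := leftSum_contiguous hq0 hq hz0 hc hd he hz ha haz
  have hright := rightSide_contiguous hq0 hq hz0 hc hd he hz ha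
  rw [threeTermDefect, threeTermDefect, hleft, hright, hprod, htheta, htheta']
  simp only [qInfs_cons, qInfs_nil, qInf_eq_mul hq z]
  field_simp
  ring

theorem theta_one (hq0 : q ≠ 0) (hq : ‖q‖ < 1) : theta q 1 = 0 := by
  rw [theta_eq_qInf_mul_qInf hq0 hq one_ne_zero, qInf_one hq, zero_mul]

theorem threeTermDefect_self (hq0 : q ≠ 0) (hq : ‖q‖ < 1) (hz0 : z ≠ 0) (c d e : ℂ) :
    threeTermDefect q c d e z z = 0 := by
  have hright : rightSum q c d e z z = qInfs q [q, q / z, q / c, q / d, q / e, q / z] := by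
    rw [rightSum, WReg_eq_qInfs_of_one_mem (by simp [hz0]), WLower_right hz0,
      show z * q / z ^ 2 = q / z by field_simp]
  rw [threeTermDefect, rightSide, hright, div_self hz0, theta_one hq0 hq,
    mul_div_cancel_left₀ q hz0]
  simp only [qInfs_cons, qInfs_nil, qInf_eq_mul hq z]
  field_simp
  ring

theorem threeTermDefect_one (hq0 : q ≠ 0) (hq : ‖q‖ < 1) {a : ℂ} (ha : a ≠ 0) (c d e : ℂ) :
    threeTermDefect q c d e 1 a = 0 := by
  rw [threeTermDefect, leftSum, WReg_eq_qInfs_of_one_mem (by simp), WLower_left ha, rightSide]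
  simp only [qInfs_cons, qInfs_nil, div_one, one_mul, mul_one, theta_eq_qInf_mul_qInf hq0 hq ha]
  ring

section Holomorphy

variable {U : Set ℂ}

theorem differentiableOn_theta (hq0 : q ≠ 0) (hq : ‖q‖ < 1) :
    DifferentiableOn ℂ (theta q) {0}ᶜ := by
  have hprod : DifferentiableOn ℂ (fun x => qInf q x * qInf q (q / x)) {0}ᶜ :=
    (differentiable_qInf hq).differentiableOn.mul <|
      (differentiable_qInf hq).comp_differentiableOn <|
        (differentiableOn_const q).div differentiableOn_id fun x hx => hx
  exact hprod.congr fun x hx => theta_eq_qInf_mul_qInf hq0 hq hx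

theorem differentiableOn_leftSum (hq : ‖q‖ < 1) (hU : IsOpen U) (hU0 : ∀ a ∈ U, a ≠ 0)
    (hUz : ∀ a ∈ U, ‖a * q / z‖ < 1) (hz0 : z ≠ 0) (hc : c ≠ 0) (hd : d ≠ 0) (he : e ≠ 0) :
    DifferentiableOn ℂ (leftSum q c d e z) U :=
  differentiableOn_WReg (A := fun a => a) (Z := fun a => a * q / z)
    (fs := [fun _ => c, fun _ => d, fun _ => e, fun a => a / z, fun _ => z]) hq hU
    differentiableOn_id (fun f hf => by fin_cases hf <;> fun_prop)
    (by simpa [hc, hd, he, hz0] using hU0) (by fun_prop) hUz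

theorem differentiableOn_rightSum (hq : ‖q‖ < 1) (hU : IsOpen U) (hU0 : ∀ a ∈ U, a ≠ 0)
    (hz0 : z ≠ 0) (hc : c ≠ 0) (hd : d ≠ 0) (he : e ≠ 0) :
    DifferentiableOn ℂ (rightSum q c d e z) U :=
  differentiableOn_WReg (A := fun _ => 1 / z) (Z := fun _ => q)
    (fs := [fun a => a / z, fun _ => c / z, fun _ => d / z, fun _ => e / z, fun a => z / a]) hq hU
    (differentiableOn_const _) (fun f hf => by fin_cases hf <;> fun_prop (disch := assumption))
    (by simpa [hc, hd, he, hz0] using hU0) (differentiableOn_const q) fun _ _ => hq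

theorem differentiableOn_rightSide (hq : ‖q‖ < 1) (hU : IsOpen U) (hU0 : ∀ a ∈ U, a ≠ 0)
    (hz0 : z ≠ 0) (hc : c ≠ 0) (hd : d ≠ 0) (he : e ≠ 0) :
    DifferentiableOn ℂ (rightSide q c d e z) U := by
  have hcoeff := differentiableOn_qInfs_map (U := U) hq
    (fs := [fun _ => z * q, fun _ => q, fun a => a * q, fun a => c * (a / z),
      fun a => d * (a / z), fun a => e * (a / z)]) fun f hf => by fin_cases hf <;> fun_prop
  have hprod := differentiableOn_qInfs_map (U := U) hq
    (fs := [fun _ => q, fun _ => q, fun _ => q / z, fun _ => c, fun _ => d, fun _ => e,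
      fun a => a * q, fun a => q / a, fun a => a, fun a => a * q / z / c, fun a => a * q / z / d,
      fun a => a * q / z / e]) fun f hf => by fin_cases hf <;> fun_prop (disch := assumption)
  exact ((hcoeff.const_mul _).mul (differentiableOn_rightSum hq hU hU0 hz0 hc hd he)).add
    (hprod.const_mul _)

theorem differentiableOn_threeTermDefect (hq0 : q ≠ 0) (hq : ‖q‖ < 1) (hU : IsOpen U)
    (hU0 : ∀ a ∈ U, a ≠ 0) (hUz : ∀ a ∈ U, ‖a * q / z‖ < 1) (hz0 : z ≠ 0) (hc : c ≠ 0)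
    (hd : d ≠ 0) (he : e ≠ 0) : DifferentiableOn ℂ (threeTermDefect q c d e z) U := by
  have htheta : DifferentiableOn ℂ (fun a => theta q (a / z)) U :=
    (differentiableOn_theta hq0 hq).comp (by fun_prop) fun a ha => div_ne_zero (hU0 a ha) hz0
  exact ((htheta.mul_const _).mul (differentiableOn_leftSum hq hU hU0 hUz hz0 hc hd he)).sub
    (differentiableOn_rightSide hq hU hU0 hz0 hc hd he)

end Holomorphy

theorem theta_ne_zero_of_ne_one (hq0 : q ≠ 0) (hq : ‖q‖ < 1) (hz0 : z ≠ 0) (hz1 : z ≠ 1)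
    (hzq : ∀ n : ℕ, z * q * q ^ n ≠ 1) (hqz : ∀ n : ℕ, q / z * q ^ n ≠ 1) : theta q z ≠ 0 := by
  rw [theta_eq_qInf_mul_qInf hq0 hq hz0, qInf_eq_mul hq z]
  exact mul_ne_zero (mul_ne_zero (sub_ne_zero.2 hz1.symm) (qInf_ne_zero hq hzq))
    (qInf_ne_zero hq hqz)

theorem norm_mul_div_lt_one_iff (hq0 : q ≠ 0) (hz0 : z ≠ 0) (a : ℂ) :
    ‖a * q / z‖ < 1 ↔ a ∈ ball (0 : ℂ) ‖z / q‖ := by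
  rw [mem_ball_zero_iff, norm_div, norm_div, norm_mul, div_lt_one (norm_pos_iff.2 hz0),
    lt_div_iff₀ (norm_pos_iff.2 hq0)]

theorem threeTermDefect_eq_zero (hq0 : q ≠ 0) (hq : ‖q‖ < 1) (hz0 : z ≠ 0) (hc : c ≠ 0)
    (hd : d ≠ 0) (he : e ≠ 0) (hz : z * q = c * d * e)
    (hzq : ∀ n : ℕ, z * q * q ^ n ≠ 1) (hqz : ∀ n : ℕ, q / z * q ^ n ≠ 1)
    (hqc : ∀ n : ℕ, q / c * q ^ n ≠ 1) (hqd : ∀ n : ℕ, q / d * q ^ n ≠ 1)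
    (hqe : ∀ n : ℕ, q / e * q ^ n ≠ 1) {a : ℂ} (ha : a ≠ 0) (haz : ‖a * q / z‖ < 1) :
    threeTermDefect q c d e z a = 0 := by
  obtain rfl | hz1 := eq_or_ne z 1
  · exact threeTermDefect_one hq0 hq ha c d e
  have hdisc := norm_mul_div_lt_one_iff hq0 hz0
  have hdiff := differentiableOn_threeTermDefect (U := ball (0 : ℂ) ‖z / q‖ \ {0}) hq0 hq
    (isOpen_ball.sdiff isClosed_singleton) (fun a ha => ha.2) (fun a ha => (hdisc a).2 ha.1)
    hz0 hc hd he
  have hroots : qInfs q ([q, q / z / c, q / z / d, q / z / e].map (· * z)) ≠ 0 := by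
    have hcancel : ∀ w, q / z / w * z = q / w := fun w => by field_simp
    refine qInfs_ne_zero hq ?_
    simp only [List.map_cons, List.map_nil, List.forall_mem_cons, List.not_mem_nil,
      IsEmpty.forall_iff, implies_true, and_true, hcancel, mul_comm q z]
    exact ⟨hzq, hqc, hqd, hqe⟩
  exact eqOn_zero_of_eq_neg_mul_prod_mul hq0 hq hdiff
    (fun w hw => threeTermDefect_contiguous hq0 hq hz0 hc hd he hz hw.2 ((hdisc w).2 hw.1))
    ⟨(hdisc z).1 (by rwa [mul_div_cancel_left₀ q hz0]), hz0⟩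
    (threeTermDefect_self hq0 hq hz0 c d e) hroots
    (theta_ne_zero_of_ne_one hq0 hq hz0 hz1 hzq hqz) ⟨(hdisc a).1 haz, ha⟩

end ThreeTerm

section Coefficients

variable {q a c d e z : ℂ}

theorem Omega_singleton (q x : ℂ) (bs : List ℂ) : Omega q [x] bs = qInfs q (bs.map (x / ·)) := by
  simp [Omega, qInfs, Function.comp_def]

theorem rightSum_coefficient_eq (hq : ‖q‖ < 1) (hz0 : z ≠ 0) (hc : c ≠ 0) (hd : d ≠ 0)
    (he : e ≠ 0) (hz : z * q = c * d * e) (ha : a ≠ 0) (hzq : ∀ n : ℕ, z * q * q ^ n ≠ 1) :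
    (1 - 1 / z) * (qInfs q [q, a * q, q / a, a * q / z ^ 2] / (theta q (a / z) * qInf q (q / z))) *
        (Omega q [q] [c, d, e] * Omega q [a * q] [c * d, c * e, d * e] /
          (Omega q [a * q] [c, d, e, z] * Omega q [1 / z] [1 / c, 1 / d, 1 / e])) =
      (1 - 1 / z) * qInfs q [z * q, q, a * q, c * (a / z), d * (a / z), e * (a / z)] *
          qInfs q (WLower (1 / z) [a / z, c / z, d / z, e / z, z / a] q) /
        (theta q (a / z) * qInfs q [q / z, c / z, d / z, e / z] *
          qInfs q (WLower a [c, d, e, a / z, z] q)) := by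
  have hcancel : qInf q q * qInf q (z * q) ≠ 0 :=
    mul_ne_zero (qInf_self_ne_zero hq) (qInf_ne_zero hq hzq)
  have hcd : a * q / (c * d) = e * (a / z) := by field_simp; linear_combination hz
  have hce : a * q / (c * e) = d * (a / z) := by field_simp; linear_combination hz
  have hde : a * q / (d * e) = c * (a / z) := by field_simp; linear_combination hz
  have hdiv : ∀ w, 1 / z / (1 / w) = w / z := fun w => by field_simp
  rw [mul_assoc, div_mul_div_comm, ← mul_div_assoc, ← mul_div_mul_right _ _ hcancel,
    WLower_left ha, WLower_right hz0]
  simp only [Omega_singleton, List.map_cons, List.map_nil, qInfs_cons, qInfs_nil, hcd, hce, hde,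
    hdiv]
  congr 1 <;> ring

theorem inhomogeneousTerm_eq (hq : ‖q‖ < 1) (hz0 : z ≠ 0) (ha : a ≠ 0)
    (hqz : ∀ n : ℕ, q / z * q ^ n ≠ 1) :
    1 / z * (qInfs q [q, a * q, q / a, a] / (theta q (a / z) * qInf q (z * q))) *
        (Omega q [1] [1 / c, 1 / d, 1 / e] * Omega q [a * q / z] [c, d, e] /
          (Omega q [1 / z] [1 / c, 1 / d, 1 / e] * Omega q [a * q] [c, d, e, z])) =
      1 / z * qInfs q [q, q, q / z, c, d, e, a * q, q / a, a, a * q / z / c, a * q / z / d,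
          a * q / z / e] /
        (theta q (a / z) * qInfs q [q / z, c / z, d / z, e / z] *
          qInfs q (WLower a [c, d, e, a / z, z] q)) := by
  have hcancel : qInf q q * qInf q (q / z) ≠ 0 :=
    mul_ne_zero (qInf_self_ne_zero hq) (qInf_ne_zero hq hqz)
  have hdiv : ∀ w, 1 / z / (1 / w) = w / z := fun w => by field_simp
  rw [mul_assoc, div_mul_div_comm, ← mul_div_assoc, ← mul_div_mul_right _ _ hcancel,
    WLower_left ha]
  simp only [Omega_singleton, List.map_cons, List.map_nil, qInfs_cons, qInfs_nil, hdiv,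
    one_div_one_div]
  congr 1 <;> ring

end Coefficients

end BasicHyp

open BasicHyp in
theorem mainTheorem10 (q a c d e z : ℂ)
    (hq0 : q ≠ 0) (hq1 : ‖q‖ < 1)
    (ha : a ≠ 0) (hc : c ≠ 0) (hd : d ≠ 0) (he : e ≠ 0)
    (hz : z * q = c * d * e) (hconv : ‖a * q / z‖ < 1)
    -- no denominator vanishes: `(aq/c, aq/d, aq/e, zq; q)_n`
    (hac : ∀ n : ℕ, a * q / c * q ^ n ≠ 1) (had : ∀ n : ℕ, a * q / d * q ^ n ≠ 1)
    (hae : ∀ n : ℕ, a * q / e * q ^ n ≠ 1) (hzq : ∀ n : ℕ, z * q * q ^ n ≠ 1)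
    -- `(q/a, q/c, q/d, q/e, aq/z²; q)_n`
    (hqa : ∀ n : ℕ, q / a * q ^ n ≠ 1) (hqc : ∀ n : ℕ, q / c * q ^ n ≠ 1)
    (hqd : ∀ n : ℕ, q / d * q ^ n ≠ 1) (hqe : ∀ n : ℕ, q / e * q ^ n ≠ 1)
    (hazz : ∀ n : ℕ, a * q / z ^ 2 * q ^ n ≠ 1)
    -- `θ(a/z)` and `(q/z, c/z, d/z, e/z; q)_∞`
    (hth : ∀ m : ℤ, a / z * q ^ m ≠ 1) (hqz : ∀ n : ℕ, q / z * q ^ n ≠ 1)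
    (hcz : ∀ n : ℕ, c / z * q ^ n ≠ 1) (hdz : ∀ n : ℕ, d / z * q ^ n ≠ 1)
    (hez : ∀ n : ℕ, e / z * q ^ n ≠ 1) :
    Summable (WTerm a [c, d, e, a / z, z] q (a * q / z)) ∧
    Summable (WTerm (1 / z) [a / z, c / z, d / z, e / z, z / a] q q) ∧
    W a [c, d, e, a / z, z] q (a * q / z)
      = (1 - 1 / z)
          * (qInfs q [q, a * q, q / a, a * q / z ^ 2] / (theta q (a / z) * qInf q (q / z)))
          * (Omega q [q] [c, d, e] * Omega q [a * q] [c * d, c * e, d * e]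
              / (Omega q [a * q] [c, d, e, z] * Omega q [1 / z] [1 / c, 1 / d, 1 / e]))
          * W (1 / z) [a / z, c / z, d / z, e / z, z / a] q q
        + 1 / z
          * (qInfs q [q, a * q, q / a, a] / (theta q (a / z) * qInf q (z * q)))
          * (Omega q [1] [1 / c, 1 / d, 1 / e] * Omega q [a * q / z] [c, d, e]
              / (Omega q [1 / z] [1 / c, 1 / d, 1 / e] * Omega q [a * q] [c, d, e, z])) := by
  have hz0 : z ≠ 0 := left_ne_zero_of_mul (hz ▸ mul_ne_zero (mul_ne_zero hc hd) he)
  have haz : ∀ n : ℕ, a * q / z * q ^ n ≠ 1 := fun n => by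
    simpa only [zpow_natCast, pow_succ', mul_div_right_comm, mul_assoc] using hth ↑(n + 1)
  have htheta : theta q (a / z) ≠ 0 := theta_ne_zero hq0 hq1 (div_ne_zero ha hz0) fun n h =>
    hth (-n) (by rw [h, zpow_neg, mul_inv_cancel₀ (zpow_ne_zero n hq0)])
  have hself := self_mul_qpow_ne_one hq1
  have hleft : ∀ x ∈ WLower a [c, d, e, a / z, z] q, ∀ n : ℕ, x * q ^ n ≠ 1 := by
    simpa [WLower_left ha] using ⟨hself, hac, had, hae, hzq, haz⟩
  have hright : ∀ x ∈ WLower (1 / z) [a / z, c / z, d / z, e / z, z / a] q,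
      ∀ n : ℕ, x * q ^ n ≠ 1 := by
    rw [WLower_right hz0]
    simpa using ⟨hself, hqa, hqc, hqd, hqe, hazz⟩
  refine ⟨summable_WTerm hq1 hleft hconv, summable_WTerm hq1 hright hq1, ?_⟩
  have hΩ : qInfs q [q / z, c / z, d / z, e / z] ≠ 0 :=
    qInfs_ne_zero hq1 (by simpa using ⟨hqz, hcz, hdz, hez⟩)
  have hrel := sub_eq_zero.1
    (threeTermDefect_eq_zero hq0 hq1 hz0 hc hd he hz hzq hqz hqc hqd hqe ha hconv)
  rw [W_eq_WReg_div hq1 hleft, W_eq_WReg_div hq1 hright, ← leftSum, ← rightSum,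
    eq_div_of_mul_eq (mul_ne_zero htheta hΩ) (mul_comm _ _ |>.trans hrel), rightSide,
    rightSum_coefficient_eq hq1 hz0 hc hd he hz ha hzq, inhomogeneousTerm_eq hq1 hz0 ha hqz]
  have hlower := qInfs_ne_zero hq1 hright
  field_simp
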